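/- Let $H_1,H_2$ be real Hilbert spaces and $A:H_1\to H_2$ a bounded linear operator with a wavelet--vaguelette decomposition: there are an orthonormal basis $(\phi_j)_{j\ge1}$ of $H_1$, sequences $(\psi_j),(\eta_j)$ in $H_2$ and numbers $\nu_j>0$ with $A\phi_j=\nu_j^{-1}\eta_j$, $A^*\psi_j=\nu_j^{-1}\phi_j$, $\langle\eta_i,\psi_j\rangle=1$ if $i=j$ and $0$ otherwise, and $c_\psi^2\|a\|^2\le\|\sum_j a_j\psi_j\|^2\le C_\psi^2\|a\|^2$, $c_\eta^2\|a\|^2\le\|\sum_j a_j\eta_j\|^2\le C_\eta^2\|a\|^2$ for all coefficient vectors $a$, where $c_\psi,C_\psi,c_\eta,C_\eta>0$ are absolute constants. Assume that $$\aleph_1 j^\gamma e^{\alpha j^\beta}\le|\nu_j|\le\aleph_2 j^\gamma e^{\alpha j^\beta},\qquad j\ge1,$$ with absolute constants $\aleph_1,\aleph_2>0$, where either $\alpha=\beta=0$ and $\gamma>0$, or $\alpha,\beta>0$ and $\gamma\ge0$. Let $r\ge1/2$, $\mathcal A>0$ and $$\mathcal S(r,\mathcal A)=\Big\{h=\sum_j\theta_j\phi_j:\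 \sum_{j\ge1}|\theta_j|^2j^{2r}\le\mathcal A^2\Big\}.$$ For $1\le K_*\le M$ let $\mathcal F$ be the set of all $f=(f_1,\dots,f_M)$ of the form $f_m=h_{z(m)}$ with $h_1,\dots,h_{K_*}\in\mathcal S(r,\mathcal A)$ and $z:\{1,\dots,M\}\to\{1,\dots,K_*\}$. For noise level $\delta\in(0,1]$ and $n=\lfloor\delta^{-2}\rfloor$ one observes the $n\times M$ matrix $Y$ with entries $Y_{j,m}=\langle Af_m,\psi_j\rangle+\delta\,\xi_m(\psi_j)$, where $\xi_1,\dots,\xi_M$ are independent Gaussian white noises on $H_2$, that is, the $\xi_m(\psi)$ are jointly Gaussian and centred with $\mathbb E[\xi_m(\psi)\xi_l(\psi')]=\langle\psi,\psi'\rangle$ if $m=l$ and $0$ if $m\ne l$. Put, if $\alpha=\beta=0$, $$R_{\min}(M,K_*,\delta)=\max\Big\{(\delta^2\ln K_*)^{\frac{2r}{2r+2\gamma}},\ (\delta^2M^{-1}K_*)^{\frac{2r}{2r+2\gamma+1}}\Big\},$$ and, if $\alpha,\beta>0$, $$R_{\min}(M,K_*,\delta)=\max\Big\{\Big[\ln\frac1{\delta^2\ln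 K_*}\Big]^{-\frac{2r}\beta},\ \Big[\ln\frac M{\delta^2K_*}\Big]^{-\frac{2r}\beta}\Big\},$$ where the first term is read as $0$ if $K_*=1$. Then for every $c>0$ there are $C>0$ and $\delta_0>0$, depending only on $\alpha,\beta,\gamma,r,\mathcal A$, on the absolute constants $\aleph_1,c_\psi$, and on $c$, such that for all $\delta\in(0,1]$ (with $\delta\le\delta_0$ in the case $\alpha>0$) and all $1\le K_*\le M$ with $\ln M\le c\ln(1/\delta)$, every estimator $\hat f=(\hat f_1,\dots,\hat f_M)$ that is a measurable function of $Y$ satisfies, for some $f\in\mathcal F$, $$\mathbb P_f\Big(\frac1M\sum_{m=1}^M\|\hat f_m-f_m\|^2\ \ge\ C\,R_{\min}(M,K_*,\delta)\Big)\ \ge\ 0.1 .$$ -/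

import Mathlib

open MeasureTheory ProbabilityTheory

noncomputable section

namespace ClusterInverse

variable {H₁ H₂ Ω : Type*}
  [NormedAddCommGroup H₁] [InnerProductSpace ℝ H₁] [CompleteSpace H₁]
  [NormedAddCommGroup H₂] [InnerProductSpace ℝ H₂] [CompleteSpace H₂]
  [MeasurableSpace Ω]

/-- Wavelet-vaguelette decomposition of the operator `A`. Sequences are indexed by `ℕ`; the entry
with index `j` is the one that carries the number `j + 1` when one counts from `1`.
The two-sided (Riesz) bounds are stated for all finitely supported coefficient vectors. -/
structure IsWVD (A : H₁ →L[ℝ] H₂) (φ : HilbertBasis ℕ ℝ H₁) (ψ η : ℕ → H₂) (ν : ℕ → ℝ)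
    (cψ Cψ cη Cη : ℝ) : Prop where
  nu_pos : ∀ j, 0 < ν j
  map_phi : ∀ j, A (φ j) = (ν j)⁻¹ • η j
  adjoint_psi : ∀ j, A.adjoint (ψ j) = (ν j)⁻¹ • φ j
  biorthogonal : ∀ i j, inner ℝ (η i) (ψ j) = if i = j then 1 else 0
  psi_lower : ∀ (s : Finset ℕ) (a : ℕ → ℝ),
    cψ ^ 2 * ∑ j ∈ s, a j ^ 2 ≤ ‖∑ j ∈ s, a j • ψ j‖ ^ 2
  psi_upper : ∀ (s : Finset ℕ) (a : ℕ → ℝ),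
    ‖∑ j ∈ s, a j • ψ j‖ ^ 2 ≤ Cψ ^ 2 * ∑ j ∈ s, a j ^ 2
  eta_lower : ∀ (s : Finset ℕ) (a : ℕ → ℝ),
    cη ^ 2 * ∑ j ∈ s, a j ^ 2 ≤ ‖∑ j ∈ s, a j • η j‖ ^ 2
  eta_upper : ∀ (s : Finset ℕ) (a : ℕ → ℝ),
    ‖∑ j ∈ s, a j • η j‖ ^ 2 ≤ Cη ^ 2 * ∑ j ∈ s, a j ^ 2

/-- The degree of ill-posedness: with `x = j + 1` (counting from `1`),
`ℵ₁ x ^ γ exp (α x ^ β) ≤ |ν| ≤ ℵ₂ x ^ γ exp (α x ^ β)`. -/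
def IllPosed (ν : ℕ → ℝ) (ℵ₁ ℵ₂ α β γ : ℝ) : Prop :=
  ∀ j : ℕ,
    ℵ₁ * ((j : ℝ) + 1) ^ γ * Real.exp (α * ((j : ℝ) + 1) ^ β) ≤ |ν j| ∧
    |ν j| ≤ ℵ₂ * ((j : ℝ) + 1) ^ γ * Real.exp (α * ((j : ℝ) + 1) ^ β)

/-- `M` independent Gaussian white noises on `H₂`: a jointly Gaussian centred family
`ξ m ψ` with covariance `⟪ψ₁, ψ₂⟫` for equal first indices and `0` for different ones. -/
structure IsWhiteNoise {M : ℕ} (ξ : Fin M → H₂ → Ω → ℝ) (P : Measure Ω) : Prop where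
  gaussian : IsGaussianProcess (fun p : Fin M × H₂ => ξ p.1 p.2) P
  mean_zero : ∀ m ψ, ∫ ω, ξ m ψ ω ∂P = 0
  covariance : ∀ m l ψ₁ ψ₂,
    ∫ ω, ξ m ψ₁ ω * ξ l ψ₂ ω ∂P = if m = l then inner ℝ ψ₁ ψ₂ else 0

/-- The ball `S(r, 𝒜)` of all `h` with `∑ (j + 1) ^ (2 r) |θ_j| ^ 2 ≤ 𝒜 ^ 2`, where the `θ_j` are
the coefficients of `h` in the basis `φ`. -/
def sobolevBall (φ : HilbertBasis ℕ ℝ H₁) (r 𝒜 : ℝ) : Set H₁ :=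
  {h | Summable (fun j : ℕ => |inner ℝ (φ j) h| ^ 2 * ((j : ℝ) + 1) ^ (2 * r)) ∧
    ∑' j : ℕ, |inner ℝ (φ j) h| ^ 2 * ((j : ℝ) + 1) ^ (2 * r) ≤ 𝒜 ^ 2}

/-- All vectors `f = (f_1, …, f_M)` with `f_m = h_{z(m)}` for some clustering function
`z : [M] → [K]` and some `h_1, …, h_K ∈ S(r, 𝒜)`. -/
def clusteredClass (φ : HilbertBasis ℕ ℝ H₁) (r 𝒜 : ℝ) (M K : ℕ) : Set (Fin M → H₁) :=
  {f | ∃ (z : Fin M → Fin K) (h : Fin K → H₁),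
    (∀ k, h k ∈ sobolevBall φ r 𝒜) ∧ ∀ m, f m = h (z m)}

/-- The cut-off `n = [δ⁻²]`. -/
def cutoff (δ : ℝ) : ℕ := ⌊(δ ^ 2)⁻¹⌋₊

/-- The `n × M` matrix of observations `Y_{j,m} = ⟪A f_m, ψ_j⟫ + δ ξ_m(ψ_j)`, `n = [δ⁻²]`. -/
def observation {M : ℕ} (A : H₁ →L[ℝ] H₂) (ψ : ℕ → H₂) (ξ : Fin M → H₂ → Ω → ℝ) (δ : ℝ)
    (f : Fin M → H₁) (ω : Ω) : Fin (cutoff δ) → Fin M → ℝ :=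
  fun j m => inner ℝ (A (f m)) (ψ j) + δ * ξ m (ψ j) ω

/-- The average error `M⁻¹ ∑ ‖g_m - f_m‖ ^ 2`. -/
def avgError {M : ℕ} (f g : Fin M → H₁) : ℝ :=
  (M : ℝ)⁻¹ * ∑ m, ‖g m - f m‖ ^ 2

/-- The rate for `α = β = 0`. -/
def rateModerate (γ r : ℝ) (M K : ℕ) (δ : ℝ) : ℝ :=
  max ((δ ^ 2 * Real.log K) ^ (2 * r / (2 * r + 2 * γ)))
    ((δ ^ 2 * (M : ℝ)⁻¹ * K) ^ (2 * r / (2 * r + 2 * γ + 1)))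

/-- The rate for `α, β > 0`. The first term is `0` for `K = 1`. -/
def rateSevere (β r : ℝ) (M K : ℕ) (δ : ℝ) : ℝ :=
  max (if K = 1 then 0 else (Real.log (1 / (δ ^ 2 * Real.log K))) ^ (-(2 * r / β)))
    ((Real.log (M / (δ ^ 2 * K))) ^ (-(2 * r / β)))

/-- The rate `R_min(M, K, δ)`. -/
def rateMin (α β γ r : ℝ) (M K : ℕ) (δ : ℝ) : ℝ :=
  if α = 0 then rateModerate γ r M K δ else rateSevere β r M K δ

end ClusterInverse

end

open ClusterInverse

/-!
The bound is Assouad's, applied to two families of coefficient cubes, one for each term of the rate.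

Fix a block of `d ≤ J` consecutive basis functions `φ_J, …, φ_{J+d-1}` and let each function in the
block be switched on with amplitude `a` or off, where `d a² ≍ J ^ (-2r)`; all `2 ^ d` vertices of
this cube lie in `S(r, 𝒜)` (`cubeVertex_mem_sobolevBall`). Flipping one bit that is shared by `N` of
the `M` functions moves the mean of the observations, in column `m`, by `±a (⟪A φ_j, ψ_i⟫)_i`.
Only the inner products with the observed `ψ_i` matter, so `A φ_j` may be replaced by its projection
on their span, whose norm is at most `1 / (cψ ν_j)` by the lower Riesz bound
(`IsWVD.exists_representer`). A shift of white noise by such a vector is a shift of one standard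
normal variable, independent of the rest (`IsWhiteNoise.measureReal_le_shift`), hence the two
hypotheses cannot be told apart with error probabilities summing to less than `1 / 2` as soon as
`N a² ≤ δ² cψ² ν_j² / 5`. Averaging over the cube, some vertex has an expected proportion of at
least `1 / 4` wrong bits. As the proportion is at most one, it is then at least `3 / 20` with
probability at least `1 / 10` (`exists_cube_avgError_ge`), and in this event the average error is at
least `3 d a² / 80 ≍ J ^ (-2r)`.

* For the second term of the rate, the clusters are fixed and balanced, each with at most `2 M / K`
  members, and each cluster carries its own vertex of the cube
  (`exists_avgError_ge_of_known_clusters`).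
* For the first term, `2 ^ d ≤ K`, so that the `K` centres can be all the vertices of the cube; then
  every one of the `M` functions ranges freely over the cube, and `N = 1`
  (`exists_avgError_ge_of_full_cube`). This replaces a packing of the set of clusterings.

It remains to choose `J` as small as the condition on `N a²` permits. In the mildly ill-posed case
the second term has `d = J` and the first `d = ⌊log₂ K⌋`, where `d ≤ J` up to a constant because
`ln K ≤ c ln δ⁻¹`. In the severely ill-posed case `d = 1` is enough, since the same inequality makes
`ln (1 / (δ² ln K))` at least `ln δ⁻¹` for small `δ`.
-/

open ClusterInverse

/-! ### Shifts of Gaussian variables and of white noise -/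

/-- The total variation distance of `N(0, 1)` and `N(σ, 1)` is at most `1 / 2` for `σ² ≤ 1 / 5`,
because their `χ²` distance is `exp (σ²) - 1 ≤ 1 / 4`. -/
lemma gaussianReal_apply_le_shift {σ : ℝ} (hσ : σ ^ 2 ≤ 1 / 5) (S : Set ℝ)
    (hS : MeasurableSet S) :
    gaussianReal 0 1 S ≤ gaussianReal σ 1 S + ENNReal.ofReal (1 / 2) := by
  have hint (μ : ℝ) : Integrable (gaussianPDFReal μ 1) := integrable_gaussianPDFReal μ 1
  have hone (μ : ℝ) : ∫ x, gaussianPDFReal μ 1 x = 1 :=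
    integral_gaussianPDFReal_eq_one μ one_ne_zero
  have hexp : Real.exp (σ ^ 2) ≤ 5 / 4 := by
    refine (Real.exp_le_exp.mpr hσ).trans ?_
    have h := Real.exp_bound_div_one_sub_of_interval (x := 1 / 5) (by norm_num) (by norm_num)
    norm_num at h ⊢
    exact h
  -- With `L = p_σ / p_0`, `F = p_0 (1 / 4 + (1 - L)²)`, which dominates `p_0 - p_σ = p_0 (1 - L)`;
  -- here `p_σ² / p_0 = exp (σ²) p_{2σ}`.
  set F : ℝ → ℝ := fun x => 5 / 4 * gaussianPDFReal 0 1 x - 2 * gaussianPDFReal σ 1 x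
    + Real.exp (σ ^ 2) * gaussianPDFReal (2 * σ) 1 x with hF
  have hFint : Integrable F :=
    (((hint 0).const_mul _).sub ((hint σ).const_mul _)).add ((hint (2 * σ)).const_mul _)
  have hsq (x : ℝ) : gaussianPDFReal σ 1 x ^ 2
      = Real.exp (σ ^ 2) * gaussianPDFReal (2 * σ) 1 x * gaussianPDFReal 0 1 x := by
    simp only [gaussianPDFReal]
    rw [mul_pow, ← Real.exp_nat_mul]
    have : Real.exp (σ ^ 2) * ((√(2 * Real.pi * ((1 : NNReal) : ℝ)))⁻¹ *
        Real.exp (-(x - 2 * σ) ^ 2 / (2 * ((1 : NNReal) : ℝ)))) *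
        ((√(2 * Real.pi * ((1 : NNReal) : ℝ)))⁻¹ *
          Real.exp (-(x - 0) ^ 2 / (2 * ((1 : NNReal) : ℝ))))
        = (√(2 * Real.pi * ((1 : NNReal) : ℝ)))⁻¹ ^ 2 *
        Real.exp (σ ^ 2 + -(x - 2 * σ) ^ 2 / (2 * ((1 : NNReal) : ℝ))
          + -(x - 0) ^ 2 / (2 * ((1 : NNReal) : ℝ))) := by
      rw [Real.exp_add, Real.exp_add]; ring
    rw [this]
    congr 2
    push_cast
    ring
  have hpos (x : ℝ) : 0 < gaussianPDFReal 0 1 x := gaussianPDFReal_pos 0 1 x one_ne_zero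
  have hFmul (x : ℝ) : F x * gaussianPDFReal 0 1 x = 5 / 4 * gaussianPDFReal 0 1 x ^ 2
      - 2 * gaussianPDFReal σ 1 x * gaussianPDFReal 0 1 x + gaussianPDFReal σ 1 x ^ 2 := by
    rw [hsq]; simp only [hF]; ring
  have hle (x : ℝ) : gaussianPDFReal 0 1 x - gaussianPDFReal σ 1 x ≤ F x := by
    refine le_of_mul_le_mul_right ?_ (hpos x)
    rw [hFmul]
    nlinarith [sq_nonneg (gaussianPDFReal 0 1 x / 2 - gaussianPDFReal σ 1 x)]
  have hF0 (x : ℝ) : 0 ≤ F x := by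
    refine le_of_mul_le_mul_right ?_ (hpos x)
    rw [hFmul]
    nlinarith [sq_nonneg (gaussianPDFReal 0 1 x - gaussianPDFReal σ 1 x),
      sq_nonneg (gaussianPDFReal 0 1 x)]
  have hFtot : ∫ x, F x ≤ 1 / 2 := by
    have : ∫ x, F x = 5 / 4 - 2 + Real.exp (σ ^ 2) := by
      have hadd := integral_add (((hint 0).const_mul (5 / 4)).sub ((hint σ).const_mul 2))
        ((hint (2 * σ)).const_mul (Real.exp (σ ^ 2)))
      have hsub := integral_sub ((hint 0).const_mul (5 / 4)) ((hint σ).const_mul 2)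
      simp only [Pi.sub_apply, integral_const_mul, hone] at hadd hsub
      simp only [hF, hadd, hsub]
      ring
    rw [this]; linarith
  have key : ∫ x in S, gaussianPDFReal 0 1 x ≤ (∫ x in S, gaussianPDFReal σ 1 x) + 1 / 2 := by
    have h1 : ∫ x in S, (gaussianPDFReal 0 1 x - gaussianPDFReal σ 1 x) ≤ ∫ x in S, F x :=
      setIntegral_mono ((hint 0).sub (hint σ)).integrableOn hFint.integrableOn hle
    have h2 : ∫ x in S, F x ≤ ∫ x, F x :=
      setIntegral_le_integral hFint (Filter.Eventually.of_forall hF0)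
    rw [integral_sub (hint 0).integrableOn (hint σ).integrableOn] at h1
    linarith
  rw [gaussianReal_apply_eq_integral _ one_ne_zero, gaussianReal_apply_eq_integral _ one_ne_zero,
    ← ENNReal.ofReal_add (setIntegral_nonneg hS fun x _ => gaussianPDFReal_nonneg _ _ _)
      (by norm_num)]
  exact ENNReal.ofReal_le_ofReal key

/-- The bound for a shift of a standard normal variable persists in the presence of an independent
variable `X`: condition on `X`. -/
lemma measureReal_le_shift_of_indepFun {Ω E : Type*} [MeasurableSpace Ω] [MeasurableSpace E]
    {P : Measure Ω} [IsProbabilityMeasure P] {X : Ω → E} {ζ : Ω → ℝ} (hX : AEMeasurable X P)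
    (hζm : AEMeasurable ζ P) (hζ : P.map ζ = gaussianReal 0 1) (hind : IndepFun X ζ P)
    {σ : ℝ} (hσ : σ ^ 2 ≤ 1 / 5) {T : Set (E × ℝ)} (hT : MeasurableSet T) :
    P.real {ω | (X ω, ζ ω) ∈ T} ≤ P.real {ω | (X ω, ζ ω + σ) ∈ T} + 1 / 2 := by
  have hPX : IsProbabilityMeasure (P.map X) := Measure.isProbabilityMeasure_map hX
  have h1 : P.map (fun ω => (X ω, ζ ω)) = (P.map X).prod (gaussianReal 0 1) := by
    rw [← hζ]; exact (indepFun_iff_map_prod_eq_prod_map_map hX hζm).mp hind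
  have hζσ : P.map (fun ω => ζ ω + σ) = gaussianReal σ 1 := by
    have := gaussianReal_map_add_const (μ := 0) (v := 1) σ
    rw [zero_add] at this
    rw [← this, ← hζ, AEMeasurable.map_map_of_aemeasurable (by fun_prop) hζm]
    rfl
  have h2 : P.map (fun ω => (X ω, ζ ω + σ)) = (P.map X).prod (gaussianReal σ 1) := by
    rw [← hζσ]
    exact (indepFun_iff_map_prod_eq_prod_map_map hX (by fun_prop)).mp
      (hind.comp measurable_id (measurable_id.add_const σ))
  have e1 : P {ω | (X ω, ζ ω) ∈ T} = ((P.map X).prod (gaussianReal 0 1)) T := by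
    rw [← h1, Measure.map_apply_of_aemeasurable (hX.prodMk hζm) hT]; rfl
  have e2 : P {ω | (X ω, ζ ω + σ) ∈ T} = ((P.map X).prod (gaussianReal σ 1)) T := by
    rw [← h2, Measure.map_apply_of_aemeasurable (hX.prodMk (hζm.add_const σ)) hT]; rfl
  have key : P {ω | (X ω, ζ ω) ∈ T} ≤ P {ω | (X ω, ζ ω + σ) ∈ T} + ENNReal.ofReal (1 / 2) := by
    rw [e1, e2, Measure.prod_apply hT, Measure.prod_apply hT]
    calc ∫⁻ x, gaussianReal 0 1 (Prod.mk x ⁻¹' T) ∂(P.map X)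
        ≤ ∫⁻ x, (gaussianReal σ 1 (Prod.mk x ⁻¹' T) + ENNReal.ofReal (1 / 2)) ∂(P.map X) :=
          lintegral_mono fun x => gaussianReal_apply_le_shift hσ _ (measurable_prodMk_left hT)
      _ = _ := by
          rw [lintegral_add_right _ measurable_const, lintegral_const, measure_univ, mul_one]
  have := ENNReal.toReal_mono (by finiteness) key
  rwa [ENNReal.toReal_add (by finiteness) (by finiteness),
    ENNReal.toReal_ofReal (by norm_num)] at this

lemma ProbabilityTheory.IsGaussianProcess.of_sum_mul {Ω S T : Type*} [MeasurableSpace Ω]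
    {P : Measure Ω} [Fintype T] {X : T → Ω → ℝ} (hX : IsGaussianProcess X P) (a : S → T → ℝ) :
    IsGaussianProcess (fun s ω => ∑ t, a s t * X t ω) P := by
  refine hX.of_isGaussianProcess fun s => ⟨Finset.univ,
    ∑ t, a s t.1 • ContinuousLinearMap.proj (R := ℝ) (φ := fun _ => ℝ) t, fun ω => ?_⟩
  simp only [sum_apply, smul_apply,
    ContinuousLinearMap.proj_apply, Finset.restrict_def, smul_eq_mul]
  exact (Finset.sum_coe_sort Finset.univ (fun t => a s t * X t ω)).symm

section WhiteNoise
variable {Ω H₂ : Type*} [MeasurableSpace Ω] [NormedAddCommGroup H₂] [InnerProductSpace ℝ H₂]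
  {P : Measure Ω} {M : ℕ} {ξ : Fin M → H₂ → Ω → ℝ}

lemma ClusterInverse.IsWhiteNoise.memLp [CompleteSpace H₂] (hξ : IsWhiteNoise ξ P) (m : Fin M)
    (x : H₂) : MemLp (ξ m x) 2 P := (hξ.gaussian.hasGaussianLaw_eval (m, x)).memLp_two

lemma ClusterInverse.IsWhiteNoise.cov [CompleteSpace H₂] [IsProbabilityMeasure P]
    (hξ : IsWhiteNoise ξ P) (m l : Fin M) (x y : H₂) :
    cov[ξ m x, ξ l y; P] = if m = l then inner ℝ x y else 0 := by
  rw [covariance_eq_sub (hξ.memLp m x) (hξ.memLp l y), hξ.mean_zero, hξ.mean_zero]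
  simpa using hξ.covariance m l x y

/-- Let finitely many coordinates of white noise at level `δ` be shifted by the inner products with
a vector `u` of norm at most `δ / √5`. Decompose the noise along `u`: the normalized noise `ζ` in
the direction of `u` is standard normal and independent of the remainder `X` of the observed
coordinates, and the shift only adds `‖u‖ / δ` to `ζ`. -/
lemma ClusterInverse.IsWhiteNoise.measureReal_le_shift [CompleteSpace H₂] [IsProbabilityMeasure P]
    (hξ : IsWhiteNoise ξ P) {n : ℕ} (ψ : Fin n → H₂) (u : Fin M → H₂) {δ : ℝ} (hδ : 0 < δ)
    (hu : ∑ m, ‖u m‖ ^ 2 ≤ δ ^ 2 / 5) (y : Fin n → Fin M → ℝ) {S : Set (Fin n → Fin M → ℝ)}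
    (hS : MeasurableSet S) :
    P.real {ω | (fun j m => y j m + δ * ξ m (ψ j) ω) ∈ S} ≤
      P.real {ω | (fun j m => y j m + inner ℝ (u m) (ψ j) + δ * ξ m (ψ j) ω) ∈ S} + 1 / 2 := by
  rcases (Finset.sum_nonneg fun m _ => sq_nonneg ‖u m‖ :
    0 ≤ ∑ m, ‖u m‖ ^ 2).eq_or_lt with h0 | hpos
  · have hu0 (m : Fin M) : u m = 0 := by
      have := (Finset.sum_eq_zero_iff_of_nonneg fun m _ => sq_nonneg ‖u m‖).mp h0.symm m
        (Finset.mem_univ m)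
      simpa using this
    simp [hu0]
  set s : ℝ := √(∑ m, ‖u m‖ ^ 2) with hs
  have hs0 : 0 < s := Real.sqrt_pos.mpr hpos
  have hs2 : s ^ 2 = ∑ m, ‖u m‖ ^ 2 := Real.sq_sqrt hpos.le
  set ζ : Ω → ℝ := fun ω => ∑ m, s⁻¹ * ξ m (u m) ω with hζ
  set w : Fin n → Fin M → ℝ := fun j m => s⁻¹ * inner ℝ (u m) (ψ j) with hw
  set X : Fin n × Fin M → Ω → ℝ := fun p ω => ξ p.2 (ψ p.1) ω - w p.1 p.2 * ζ ω with hX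
  have hζL : MemLp ζ 2 P := memLp_finsetSum _ fun m _ => (hξ.memLp m (u m)).const_mul _
  have hXL (p) : MemLp (X p) 2 P := (hξ.memLp _ _).sub (hζL.const_mul _)
  have hζ0 : ∫ ω, ζ ω ∂P = 0 := by
    rw [hζ, integral_finsetSum _ fun m _ =>
      ((hξ.memLp m (u m)).const_mul s⁻¹).integrable (by norm_num)]
    simp [integral_const_mul, hξ.mean_zero]
  have hcov (j : Fin n) (m : Fin M) : cov[ξ m (ψ j), ζ; P] = w j m := by
    rw [hζ, covariance_fun_sum_right (fun m => (hξ.memLp m (u m)).const_mul s⁻¹) (hξ.memLp _ _)]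
    simp only [covariance_const_mul_right, hξ.cov]
    simp [hw, real_inner_comm]
  have hvar : cov[ζ, ζ; P] = 1 := by
    nth_rw 1 [hζ]
    rw [covariance_fun_sum_left (fun m => (hξ.memLp m (u m)).const_mul s⁻¹) hζL]
    have (m : Fin M) : cov[ξ m (u m), ζ; P] = s⁻¹ * ‖u m‖ ^ 2 := by
      rw [hζ, covariance_fun_sum_right (fun m => (hξ.memLp m (u m)).const_mul s⁻¹) (hξ.memLp _ _)]
      simp only [covariance_const_mul_right, hξ.cov]
      simp
    simp only [covariance_const_mul_left, this, ← Finset.mul_sum, ← hs2]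
    field_simp
  have hcov0 (p) : cov[X p, ζ; P] = 0 := by
    rw [hX]
    change cov[(ξ p.2 (ψ p.1)) - (fun ω => w p.1 p.2 * ζ ω), ζ; P] = 0
    rw [covariance_sub_left (hξ.memLp _ _) (hζL.const_mul _) hζL, hcov, covariance_const_mul_left,
      hvar]
    ring
  -- `X` and `ζ` are finite linear combinations of values of the Gaussian process `ξ`
  have hjoint : IsGaussianProcess (Sum.elim X (fun _ : Unit => ζ)) P := by
    have h1 := hξ.gaussian.comp_right
      (Sum.elim (fun p : Fin n × Fin M => (p.2, ψ p.1)) (fun m : Fin M => (m, u m)))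
    have h2 := h1.of_sum_mul (S := (Fin n × Fin M) ⊕ Unit)
      (Sum.elim (fun p => Sum.elim (fun q => if p = q then 1 else 0) (fun _ => -(w p.1 p.2 * s⁻¹)))
        (fun _ => Sum.elim (fun _ => 0) (fun _ => s⁻¹)))
    convert h2 using 1
    funext t ω
    rcases t with p | _
    · simp [hX, hζ, Finset.mul_sum, sub_eq_add_neg, mul_assoc]
    · simp [hζ]
  have hind : IndepFun (fun ω p => X p ω) ζ P := by
    have := hjoint.indepFun_of_covariance_eq_zero
      (fun p => (hXL p).aestronglyMeasurable.aemeasurable)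
      (fun _ => hζL.aestronglyMeasurable.aemeasurable) (fun p _ => hcov0 p)
    exact this.comp measurable_id (measurable_pi_apply ())
  have hlaw : P.map ζ = gaussianReal 0 1 := by
    have h := (hjoint.hasGaussianLaw_eval (Sum.inr ())).map_eq_gaussianReal
    simp only [Sum.elim_inr] at h
    rw [h, hζ0, ← covariance_self hζL.aestronglyMeasurable.aemeasurable, hvar]
    simp
  have hσ : (s / δ) ^ 2 ≤ 1 / 5 := by
    rw [div_pow, hs2, div_le_iff₀ (by positivity)]; linarith
  set Φ : (Fin n × Fin M → ℝ) × ℝ → Fin n → Fin M → ℝ :=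
    fun x j m => y j m + δ * (x.1 (j, m) + w j m * x.2) with hΦ
  have hΦm : Measurable Φ := by fun_prop
  have := measureReal_le_shift_of_indepFun
    (aemeasurable_pi_lambda _ fun p => (hXL p).aestronglyMeasurable.aemeasurable)
    hζL.aestronglyMeasurable.aemeasurable hlaw hind hσ (hΦm hS)
  convert this using 5 with ω
  · simp [hΦ]
  · rename_i ω
    simp only [Set.mem_preimage]
    have : Φ (fun p => X p ω, ζ ω + s / δ) =
        fun j m => y j m + inner ℝ (u m) (ψ j) + δ * ξ m (ψ j) ω := by
      funext j m
      simp only [hΦ, hX, hw]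
      field_simp
      ring
    rw [this]
end WhiteNoise

/-! ### Averaging over a cube of hypotheses -/

/-- The averaging step of Assouad's method: if for each test `q` the errors at `x` and at its
neighbour `flip q x` add up to at least `1 / 2`, some `x` has mean error at least `1 / 4`. -/
lemma exists_sum_error_ge {ι Q : Type*} [Fintype ι] [Nonempty ι] [Fintype Q] (flip : Q → ι → ι)
    (hflip : ∀ q, Function.Involutive (flip q)) (e : ι → Q → ℝ)
    (he : ∀ x q, 1 / 2 ≤ e x q + e (flip q x) q) :
    ∃ x, (Fintype.card Q : ℝ) / 4 ≤ ∑ q, e x q := by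
  have hsum (q : Q) : ∑ x, e (flip q x) q = ∑ x, e x q :=
    Equiv.sum_comp (hflip q).toPerm (fun x => e x q)
  have h1 (q : Q) : (Fintype.card ι : ℝ) / 4 ≤ ∑ x, e x q := by
    have : ∑ _x : ι, (1 / 2 : ℝ) ≤ ∑ x, (e x q + e (flip q x) q) :=
      Finset.sum_le_sum fun x _ => he x q
    rw [Finset.sum_add_distrib, hsum] at this
    simp only [Finset.sum_const, Finset.card_univ, nsmul_eq_mul] at this
    linarith
  have h2 : ∑ _x : ι, (Fintype.card Q : ℝ) / 4 ≤ ∑ x, ∑ q, e x q := by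
    rw [Finset.sum_comm]
    calc ∑ _x : ι, (Fintype.card Q : ℝ) / 4 = ∑ _q : Q, (Fintype.card ι : ℝ) / 4 := by
          simp; ring
      _ ≤ _ := Finset.sum_le_sum fun q _ => h1 q
  obtain ⟨x, -, hx⟩ := Finset.exists_le_of_sum_le Finset.univ_nonempty h2
  exact ⟨x, hx⟩

/-- Reverse Markov inequality for the number of the events `S q` that occur: it is at most `t`
outside the last event, and never exceeds the number of indices. -/
lemma sum_measureReal_le {E Q : Type*} [MeasurableSpace E] [Fintype Q] (μ : Measure E)
    [IsProbabilityMeasure μ] (S : Q → Set E) (hS : ∀ q, MeasurableSet (S q)) {t : ℝ} (ht : 0 ≤ t) :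
    ∑ q, μ.real (S q) ≤
      t + Fintype.card Q * μ.real {y | t ≤ ∑ q, (S q).indicator (fun _ => (1 : ℝ)) y} := by
  set W : E → ℝ := fun y => ∑ q, (S q).indicator (fun _ => (1 : ℝ)) y with hW
  have hWm : Measurable W :=
    Finset.measurable_sum _ fun q _ => measurable_const.indicator (hS q)
  set U : Set E := {y | t ≤ W y} with hU
  have hUm : MeasurableSet U := measurableSet_le measurable_const hWm
  have hint (q : Q) : Integrable ((S q).indicator fun _ => (1 : ℝ)) μ :=
    (integrable_const (1 : ℝ)).indicator (hS q)
  have hEW : ∫ y, W y ∂μ = ∑ q, μ.real (S q) := by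
    rw [hW, integral_finsetSum _ fun q _ => hint q]
    refine Finset.sum_congr rfl fun q _ => ?_
    exact integral_indicator_one (hS q)
  have hUi : Integrable (U.indicator fun _ => (1 : ℝ)) μ := (integrable_const _).indicator hUm
  rw [← hEW]
  calc ∫ y, W y ∂μ ≤ ∫ y, (t + Fintype.card Q * U.indicator (fun _ => (1 : ℝ)) y) ∂μ := by
        refine integral_mono (integrable_finsetSum _ fun q _ => hint q)
          ((integrable_const t).add (hUi.const_mul _)) fun y => ?_
        have hWQ : W y ≤ Fintype.card Q := by
          have : W y ≤ ∑ _q : Q, (1 : ℝ) := Finset.sum_le_sum fun q _ =>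
            Set.indicator_le_self' (fun _ _ => zero_le_one) y
          simpa using this
        by_cases hy : y ∈ U
        · simp only [Set.indicator_of_mem hy]; linarith
        · simp only [Set.indicator_of_notMem hy]
          have : W y < t := not_le.mp hy
          linarith
    _ = _ := by
        rw [integral_add (integrable_const t) (hUi.const_mul _), integral_const_mul]
        have h : ∫ y, U.indicator (fun _ => (1 : ℝ)) y ∂μ = μ.real U := integral_indicator_one hUm
        rw [h]
        simp

/-! ### Cubes of coefficients -/

section Cube
variable {H₁ : Type*} [NormedAddCommGroup H₁] [InnerProductSpace ℝ H₁]

/-- The vertex of the cube with side `a` spanned by `φ_J, …, φ_{J+d-1}` that has coefficient `a`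
where `x` is true and `0` where it is false. -/
noncomputable def cubeVertex (φ : HilbertBasis ℕ ℝ H₁) (J : ℕ) (a : ℝ) {d : ℕ}
    (x : Fin d → Bool) : H₁ :=
  ∑ i, (if x i then a else 0) • φ (J + i)

variable (φ : HilbertBasis ℕ ℝ H₁) (J : ℕ) (a : ℝ) {d : ℕ} (x : Fin d → Bool)

lemma orthonormal_block : Orthonormal ℝ (fun i : Fin d => φ (J + i)) :=
  φ.orthonormal.comp (fun i : Fin d => J + (i : ℕ)) fun i j h => Fin.ext (by simpa using h)

lemma inner_cubeVertex (i : Fin d) :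
    inner ℝ (φ (J + i)) (cubeVertex φ J a x) = if x i then a else 0 :=
  (orthonormal_block φ J).inner_right_fintype (fun i => if x i then a else 0) i

lemma inner_cubeVertex_of_notMem {k : ℕ} (hk : k ∉ Finset.Ico J (J + d)) :
    inner ℝ (φ k) (cubeVertex φ J a x) = 0 := by
  rw [cubeVertex, inner_sum]
  refine Finset.sum_eq_zero fun i _ => ?_
  have hne : k ≠ J + i := by
    rintro rfl
    exact hk (by simp)
  rw [real_inner_smul_right, φ.orthonormal.2 hne, mul_zero]

lemma cubeVertex_mem_sobolevBall {r 𝒜 : ℝ} (hr : 0 ≤ r)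
    (h : d * a ^ 2 * ((J : ℝ) + d) ^ (2 * r) ≤ 𝒜 ^ 2) :
    cubeVertex φ J a x ∈ sobolevBall φ r 𝒜 := by
  set F : ℕ → ℝ := fun j => |inner ℝ (φ j) (cubeVertex φ J a x)| ^ 2 * ((j : ℝ) + 1) ^ (2 * r)
  have h0 (k : ℕ) (hk : k ∉ Finset.Ico J (J + d)) : F k = 0 := by
    simp [F, inner_cubeVertex_of_notMem φ J a x hk]
  refine ⟨summable_of_ne_finset_zero h0, ?_⟩
  rw [tsum_eq_sum h0]
  refine le_trans ?_ h
  have hle (k : ℕ) (hk : k ∈ Finset.Ico J (J + d)) :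
      F k ≤ a ^ 2 * ((J : ℝ) + d) ^ (2 * r) := by
    obtain ⟨h1, h2⟩ := Finset.mem_Ico.mp hk
    obtain ⟨i, rfl⟩ := Nat.exists_eq_add_of_le h1
    have hi : i < d := by omega
    have hin := inner_cubeVertex φ J a x ⟨i, hi⟩
    simp only at hin
    simp only [F, hin, sq_abs]
    have hid : (i : ℝ) + 1 ≤ d := by exact_mod_cast hi
    gcongr ?_ * ?_
    · split_ifs
      · exact le_rfl
      · simpa using sq_nonneg a
    · refine Real.rpow_le_rpow (by positivity) ?_ (by positivity)
      push_cast; linarith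
  refine (Finset.sum_le_sum hle).trans ?_
  simp [mul_assoc]

lemma cubeVertex_update (i : Fin d) :
    cubeVertex φ J a (Function.update x i (!x i))
      = cubeVertex φ J a x + (if x i then -a else a) • φ (J + i) := by
  have h : (if x i then -a else a) • φ (J + i)
      = ∑ k, (if k = i then (if x i then -a else a) else 0) • φ (J + k) := by
    simp [ite_smul]
  rw [cubeVertex, cubeVertex, h, ← Finset.sum_add_distrib]
  refine Finset.sum_congr rfl fun k _ => ?_
  rw [← add_smul]
  congr 1
  by_cases hk : k = i
  · subst hk
    cases x k <;> simp
  · simp [hk]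

/-- Each wrongly guessed bit, when bits are read off from `v` by comparing coefficients with
`a / 2`, costs at least `a² / 4` in the squared distance (Bessel's inequality). -/
lemma cube_error_le_norm_sq (v : H₁) (ha : 0 < a) :
    a ^ 2 / 4 *
        ∑ i : Fin d, (if (decide (a / 2 < inner ℝ (φ (J + i)) v)) ≠ x i then (1 : ℝ) else 0)
      ≤ ‖v - cubeVertex φ J a x‖ ^ 2 := by
  refine le_trans ?_ ((orthonormal_block (d := d) φ J).sum_inner_products_le
    (v - cubeVertex φ J a x) (s := Finset.univ))
  rw [Finset.mul_sum]
  refine Finset.sum_le_sum fun i _ => ?_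
  rw [inner_sub_right, inner_cubeVertex, Real.norm_eq_abs, sq_abs]
  by_cases h : a / 2 < inner ℝ (φ (J + i)) v <;> cases hx : x i <;> simp [h]
  · nlinarith
  · positivity
  · positivity
  · nlinarith

end Cube

/-! ### Representing the observed part of `A φ_j` -/

section Representer
variable {H₁ H₂ : Type*}
  [NormedAddCommGroup H₁] [InnerProductSpace ℝ H₁] [CompleteSpace H₁]
  [NormedAddCommGroup H₂] [InnerProductSpace ℝ H₂] [CompleteSpace H₂]
  {A : H₁ →L[ℝ] H₂} {φ : HilbertBasis ℕ ℝ H₁} {ψ η : ℕ → H₂} {ν : ℕ → ℝ} {cψ Cψ cη Cη : ℝ}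

lemma ClusterInverse.IsWVD.inner_map (h : IsWVD A φ ψ η ν cψ Cψ cη Cη) (i j : ℕ) :
    inner ℝ (A (φ j)) (ψ i) = if j = i then (ν j)⁻¹ else 0 := by
  rw [h.map_phi, real_inner_smul_left, h.biorthogonal]
  simp

/-- Some `u` has the same inner products with `ψ_0, …, ψ_{n-1}` as `A φ_j` and norm at most
`1 / (cψ ν_j)`, namely the orthogonal projection of `A φ_j` on their span. The norm of `A φ_j`
itself is controlled by `Cη` only, on which the constants must not depend. -/
lemma ClusterInverse.IsWVD.exists_representer (h : IsWVD A φ ψ η ν cψ Cψ cη Cη) (hcψ : 0 < cψ)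
    (n j : ℕ) : ∃ u : H₂, (∀ i : Fin n, inner ℝ u (ψ i) = inner ℝ (A (φ j)) (ψ i)) ∧
      ‖u‖ ≤ (cψ * ν j)⁻¹ := by
  set V : Submodule ℝ H₂ := Submodule.span ℝ (Set.range fun i : Fin n => ψ i) with hV
  have hVf : FiniteDimensional ℝ V := FiniteDimensional.span_of_finite ℝ (Set.finite_range _)
  set u : H₂ := V.starProjection (A (φ j)) with hu
  have huV : u ∈ V := Submodule.starProjection_apply_mem _ _
  have hin (x : H₂) (hx : x ∈ V) : inner ℝ u x = inner ℝ (A (φ j)) x := by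
    have := Submodule.starProjection_inner_eq_zero (K := V) (A (φ j)) x hx
    rw [inner_sub_left] at this
    linarith
  refine ⟨u, fun i => hin _ (Submodule.subset_span ⟨i, rfl⟩), ?_⟩
  obtain ⟨c, hc⟩ := Submodule.mem_span_range_iff_exists_fun ℝ |>.mp huV
  have hν := h.nu_pos j
  -- `b` extends the coefficients of `u` in the `ψ_i` by zero
  set b : ℕ → ℝ := fun i => if hi : i < n then c ⟨i, hi⟩ else 0 with hb
  have hub : u = ∑ i ∈ Finset.range n, b i • ψ i := by
    rw [Finset.sum_range, ← hc]
    simp [hb]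
  have hlow := h.psi_lower (Finset.range n) b
  rw [← hub] at hlow
  have hin_u : inner ℝ (A (φ j)) u = b j * (ν j)⁻¹ := by
    have hbj : j ∉ Finset.range n → b j = 0 := fun hj => by
      simp only [Finset.mem_range] at hj
      simp [hb, hj]
    rw [hub, inner_sum]
    simp only [real_inner_smul_right, h.inner_map, mul_ite, mul_zero, Finset.sum_ite_eq]
    split_ifs with hj
    · rfl
    · simp [hbj hj]
  have hbu : cψ * |b j| ≤ ‖u‖ := by
    refine le_of_sq_le_sq ?_ (norm_nonneg u)
    refine le_trans ?_ hlow
    rw [mul_pow, sq_abs]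
    gcongr
    by_cases hj : j ∈ Finset.range n
    · exact Finset.single_le_sum (f := fun i => b i ^ 2) (fun i _ => sq_nonneg _) hj
    · have : b j = 0 := by
        simp only [Finset.mem_range] at hj
        simp [hb, hj]
      rw [this]
      simpa using Finset.sum_nonneg fun i _ => sq_nonneg (b i)
  rcases (norm_nonneg u).eq_or_lt with h0 | hpos
  · rw [← h0]; positivity
  · have h1 : ‖u‖ ^ 2 = b j * (ν j)⁻¹ := by
      rw [← hin_u, ← hin u huV, real_inner_self_eq_norm_sq]
    have h2 : ‖u‖ ^ 2 ≤ ‖u‖ * (cψ * ν j)⁻¹ := by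
      rw [h1, mul_inv, ← mul_assoc]
      gcongr
      rw [← div_eq_mul_inv, le_div_iff₀ hcψ, mul_comm]
      exact (mul_le_mul_of_nonneg_left (le_abs_self _) hcψ.le).trans hbu
    nlinarith
end Representer

/-! ### Assouad's bound for the observations -/

section LowerBound
variable {H₁ H₂ Ω : Type*}
  [NormedAddCommGroup H₁] [InnerProductSpace ℝ H₁] [CompleteSpace H₁]
  [NormedAddCommGroup H₂] [InnerProductSpace ℝ H₂] [CompleteSpace H₂]
  {A : H₁ →L[ℝ] H₂} {φ : HilbertBasis ℕ ℝ H₁} {ψ η : ℕ → H₂} {ν : ℕ → ℝ} {cψ Cψ cη Cη : ℝ}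
  [MeasurableSpace Ω] {P : Measure Ω} [IsProbabilityMeasure P] {M : ℕ} {ξ : Fin M → H₂ → Ω → ℝ}

omit [CompleteSpace H₁] [CompleteSpace H₂] [IsProbabilityMeasure P] in
lemma ClusterInverse.IsWhiteNoise.aemeasurable_observation (hξ : IsWhiteNoise ξ P) (δ : ℝ)
    (f : Fin M → H₁) : AEMeasurable (observation A ψ ξ δ f) P := by
  refine aemeasurable_pi_lambda _ fun j => aemeasurable_pi_lambda _ fun m => ?_
  exact ((hξ.gaussian.aemeasurable (m, ψ j)).const_mul δ).const_add _

/-- Moving the `f_m` by multiples of a single `φ_j` changes the distribution of the observations by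
at most `1 / 2` in total variation if the multiples are small. -/
lemma observation_le_shift (hA : IsWVD A φ ψ η ν cψ Cψ cη Cη) (hcψ : 0 < cψ)
    (hξ : IsWhiteNoise ξ P) {δ : ℝ} (hδ : 0 < δ) (f f' : Fin M → H₁) (j : ℕ) (τ : Fin M → ℝ)
    (hf : ∀ m, f' m = f m + τ m • φ j)
    (hτ : ∑ m, τ m ^ 2 ≤ δ ^ 2 / 5 * (cψ * ν j) ^ 2)
    {S : Set (Fin (cutoff δ) → Fin M → ℝ)} (hS : MeasurableSet S) :
    P.real {ω | observation A ψ ξ δ f ω ∈ S} ≤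
      P.real {ω | observation A ψ ξ δ f' ω ∈ S} + 1 / 2 := by
  obtain ⟨u, hu, hun⟩ := hA.exists_representer hcψ (cutoff δ) j
  have hν := hA.nu_pos j
  have hcν : 0 < cψ * ν j := by positivity
  have hsum : ∑ m, ‖τ m • u‖ ^ 2 ≤ δ ^ 2 / 5 := by
    simp only [norm_smul, mul_pow, Real.norm_eq_abs, sq_abs, ← Finset.sum_mul]
    calc (∑ m, τ m ^ 2) * ‖u‖ ^ 2
        ≤ (δ ^ 2 / 5 * (cψ * ν j) ^ 2) * ((cψ * ν j)⁻¹) ^ 2 := by gcongr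
      _ = δ ^ 2 / 5 := by field_simp
  have := hξ.measureReal_le_shift (fun i : Fin (cutoff δ) => ψ i) (fun m => τ m • u) hδ hsum
    (fun i m => inner ℝ (A (f m)) (ψ i)) hS
  have hobs' (ω : Ω) : (fun (i : Fin (cutoff δ)) m => inner ℝ (A (f m)) (ψ i)
      + inner ℝ (τ m • u) (ψ i) + δ * ξ m (ψ i) ω) = observation A ψ ξ δ f' ω := by
    funext i m
    rw [observation, hf, map_add, map_smul, inner_add_left, real_inner_smul_left,
      real_inner_smul_left, hu]
  simp only [hobs'] at this
  exact this

/-- Assouad's bound on a product of cubes: the value of `g` tells which vertices are shared, and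
`hfib` makes neighbouring vertices statistically close. -/
lemma exists_cube_avgError_ge [MeasurableSpace H₁] [BorelSpace H₁]
    (hA : IsWVD A φ ψ η ν cψ Cψ cη Cη) (hcψ : 0 < cψ)
    (hξ : IsWhiteNoise ξ P) {δ : ℝ} (hδ : 0 < δ) {G : Type*} [Fintype G] [DecidableEq G]
    (hM : 0 < M) (g : Fin M → G) (J : ℕ) {d : ℕ} (hd : 0 < d) {a : ℝ} (ha : 0 < a)
    (hfib : ∀ (k : G) (i : Fin d), (Finset.card {m | g m = k} : ℝ) * a ^ 2
      ≤ δ ^ 2 / 5 * (cψ * ν (J + i)) ^ 2)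
    {fhat : (Fin (cutoff δ) → Fin M → ℝ) → (Fin M → H₁)} (hfhat : Measurable fhat) :
    ∃ b : G → Fin d → Bool, 1 / 10 ≤ P.real {ω | 3 / 80 * (d * a ^ 2) ≤
      avgError (fun m => cubeVertex φ J a (b (g m)))
        (fhat (observation A ψ ξ δ (fun m => cubeVertex φ J a (b (g m))) ω))} := by
  classical
  set f : (G → Fin d → Bool) → Fin M → H₁ := fun b m => cubeVertex φ J a (b (g m)) with hf
  set flip : Fin M × Fin d → (G → Fin d → Bool) → (G → Fin d → Bool) := fun q b =>
    Function.update b (g q.1) (Function.update (b (g q.1)) q.2 (!b (g q.1) q.2)) with hflip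
  -- the plug-in test of the bit with index `q` errs
  set E : (G → Fin d → Bool) → Fin M × Fin d → Set (Fin (cutoff δ) → Fin M → ℝ) := fun b q =>
    {y | decide (a / 2 < inner ℝ (φ (J + q.2)) (fhat y q.1)) ≠ b (g q.1) q.2} with hE
  have hEm (b q) : MeasurableSet (E b q) := by
    have hm : Measurable fun y => inner ℝ (φ (J + q.2)) (fhat y q.1) :=
      (continuous_const.inner continuous_id).measurable.comp
        ((measurable_pi_apply q.1).comp hfhat)
    have hlt : MeasurableSet {y | a / 2 < inner ℝ (φ (J + q.2)) (fhat y q.1)} :=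
      measurableSet_lt measurable_const hm
    cases hb : b (g q.1) q.2
    · simpa [hE, hb] using hlt
    · have hge : MeasurableSet {y | inner ℝ (φ (J + q.2)) (fhat y q.1) ≤ a / 2} :=
        measurableSet_le hm measurable_const
      simpa [hE, hb] using hge
  have hflip_apply (q b) : flip q b (g q.1) q.2 = !b (g q.1) q.2 := by simp [hflip]
  have hinv (q) : Function.Involutive (flip q) := by
    intro b
    simp [hflip]
  have hEc (b q) : E (flip q b) q = (E b q)ᶜ := by
    ext y
    simp only [hE, Set.mem_ofPred_eq, Set.mem_compl_iff, hflip_apply]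
    cases decide (a / 2 < inner ℝ (φ (J + q.2)) (fhat y q.1)) <;> cases b (g q.1) q.2 <;> simp
  have hshift (b q m) : f (flip q b) m = f b m +
      (if g m = g q.1 then (if b (g q.1) q.2 then -a else a) else 0) • φ (J + q.2) := by
    by_cases h : g m = g q.1
    · simp only [hf, hflip, h, Function.update_self, if_true]
      exact cubeVertex_update φ J a (b (g q.1)) q.2
    · simp [hf, hflip, h]
  have htest (b q) : 1 / 2 ≤ P.real {ω | observation A ψ ξ δ (f b) ω ∈ E b q}
      + P.real {ω | observation A ψ ξ δ (f (flip q b)) ω ∈ E (flip q b) q} := by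
    have h1 := observation_le_shift hA hcψ hξ hδ (f b) (f (flip q b)) (J + q.2) _ (hshift b q)
      (by
        refine le_trans (le_of_eq ?_) (hfib (g q.1) q.2)
        have (m : Fin M) : (if g m = g q.1 then (if b (g q.1) q.2 then -a else a) else 0) ^ 2
            = if g m = g q.1 then a ^ 2 else 0 := by
          split_ifs <;> simp
        simp only [this]
        rw [← Finset.sum_filter]
        simp) (hEm (flip q b) q)
    have h2 : (1 : ℝ) ≤ P.real {ω | observation A ψ ξ δ (f b) ω ∈ E b q}
        + P.real {ω | observation A ψ ξ δ (f b) ω ∈ E (flip q b) q} := by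
      refine le_trans (le_of_eq ?_) (measureReal_union_le _ _)
      have : {ω | observation A ψ ξ δ (f b) ω ∈ E b q}
          ∪ {ω | observation A ψ ξ δ (f b) ω ∈ E (flip q b) q} = Set.univ := by
        rw [hEc]
        exact Set.union_compl_self _
      rw [this, probReal_univ]
    linarith
  obtain ⟨b, hb⟩ := exists_sum_error_ge flip hinv
    (fun b q => P.real {ω | observation A ψ ξ δ (f b) ω ∈ E b q}) htest
  refine ⟨b, ?_⟩
  have hobs : AEMeasurable (observation A ψ ξ δ (f b)) P := hξ.aemeasurable_observation δ (f b)
  set μ := P.map (observation A ψ ξ δ (f b)) with hμ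
  have hμp : IsProbabilityMeasure μ := Measure.isProbabilityMeasure_map hobs
  have hmap {S : Set (Fin (cutoff δ) → Fin M → ℝ)} (hS : MeasurableSet S) :
      P.real {ω | observation A ψ ξ δ (f b) ω ∈ S} = μ.real S := by
    rw [measureReal_def, measureReal_def, hμ, Measure.map_apply_of_aemeasurable hobs hS]
    rfl
  have hcard : (Fintype.card (Fin M × Fin d) : ℝ) = M * d := by simp
  have hMR : (0 : ℝ) < M := by exact_mod_cast hM
  have hdR : (0 : ℝ) < d := by exact_mod_cast hd
  simp only [hmap (hEm b _), hcard] at hb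
  -- `1 / 4 - 3 / 20 = 1 / 10`
  have hmk := sum_measureReal_le μ (E b) (hEm b) (t := 3 / 20 * (M * d)) (by positivity)
  rw [hcard] at hmk
  have hlow : 1 / 10 ≤ μ.real {y | 3 / 20 * ((M : ℝ) * d) ≤
      ∑ q, (E b q).indicator (fun _ => (1 : ℝ)) y} := by
    have hpos : 0 < (M : ℝ) * d := by positivity
    exact le_of_mul_le_mul_left (by linarith) hpos
  have hUm : MeasurableSet {y | 3 / 20 * ((M : ℝ) * d) ≤ 
      ∑ q, (E b q).indicator (fun _ => (1 : ℝ)) y} :=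
    measurableSet_le measurable_const (Finset.measurable_sum _ fun q _ =>
      measurable_const.indicator (hEm b q))
  rw [← hmap hUm] at hlow
  refine hlow.trans (measureReal_mono fun ω hω => ?_)
  simp only [Set.mem_ofPred_eq] at hω ⊢
  set y := observation A ψ ξ δ (f b) ω
  rw [Fintype.sum_prod_type] at hω
  have herr : a ^ 2 / 4 * (3 / 20 * ((M : ℝ) * d)) ≤ ∑ m, ‖fhat y m - f b m‖ ^ 2 := by
    refine (mul_le_mul_of_nonneg_left hω (by positivity)).trans ?_
    rw [Finset.mul_sum]
    refine Finset.sum_le_sum fun m _ => ?_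
    simp only [Set.indicator_apply]
    convert! cube_error_le_norm_sq φ J a (b (g m)) (fhat y m) ha
  change _ ≤ (M : ℝ)⁻¹ * ∑ m, ‖fhat y m - f b m‖ ^ 2
  rw [le_inv_mul_iff₀ hMR]
  linarith

end LowerBound

/-! ### Known balanced clusters and the full cube -/

/-- Residues modulo `K` split `M ≥ K` items into `K` clusters of size at most `2 M / K`. -/
lemma exists_balanced_map {M K : ℕ} (hK : 1 ≤ K) (hKM : K ≤ M) :
    ∃ g : Fin M → Fin K, ∀ k, (Finset.card {m | g m = k} : ℝ) ≤ 2 * ((M : ℝ) / K) := by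
  refine ⟨fun m => ⟨m % K, Nat.mod_lt _ hK⟩, fun k => ?_⟩
  have hcard : Finset.card {m : Fin M | (⟨m % K, Nat.mod_lt _ hK⟩ : Fin K) = k} ≤ M / K + 1 := by
    rw [← Finset.card_range (M / K + 1)]
    refine Finset.card_le_card_of_injOn (fun m => (m : ℕ) / K) (fun m _ => ?_)
      fun m hm m' hm' h => ?_
    · simpa [Nat.lt_succ_iff] using Nat.div_le_div_right m.2.le
    · simp only [Finset.coe_filter, Finset.mem_univ, true_and, Set.mem_ofPred_eq] at hm hm' h
      have hmod : (m : ℕ) % K = (m' : ℕ) % K := by simpa using hm.trans hm'.symm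
      refine Fin.ext ?_
      rw [← Nat.div_add_mod m K, ← Nat.div_add_mod m' K, hmod, h]
  have hKR : (0 : ℝ) < K := by exact_mod_cast hK
  have h1 : 1 ≤ (M : ℝ) / K := by rw [le_div_iff₀ hKR, one_mul]; exact_mod_cast hKM
  have h2 : ((M / K : ℕ) : ℝ) ≤ (M : ℝ) / K := Nat.cast_div_le
  have h3 : ((M / K + 1 : ℕ) : ℝ) = ((M / K : ℕ) : ℝ) + 1 := by push_cast; ring
  calc _ ≤ ((M / K + 1 : ℕ) : ℝ) := by exact_mod_cast hcard
    _ ≤ _ := by rw [h3]; linarith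

lemma ClusterInverse.IllPosed.le_abs {ν : ℕ → ℝ} {ℵ₁ ℵ₂ α β γ : ℝ} (h : IllPosed ν ℵ₁ ℵ₂ α β γ)
    (hℵ₁ : 0 ≤ ℵ₁) (hα : 0 ≤ α) (hβ : 0 ≤ β) (hγ : 0 ≤ γ) {J j : ℕ} (hJj : J ≤ j) :
    ℵ₁ * (J : ℝ) ^ γ * Real.exp (α * (J : ℝ) ^ β) ≤ |ν j| := by
  refine le_trans ?_ (h j).1
  have : (J : ℝ) ≤ (j : ℝ) + 1 := by
    have : (J : ℝ) ≤ j := by exact_mod_cast hJj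
    linarith
  gcongr

/-- The constant `κ` in `d a² = κ J ^ (-2r)`: the first entry keeps the cube inside `S(r, 𝒜)`, whose
weights on the block are at most `(2 J) ^ (2r)`, the second keeps neighbours indistinguishable. -/
noncomputable def amplitude (r 𝒜 ℵ₁ cψ : ℝ) : ℝ :=
  min (𝒜 ^ 2 / 2 ^ (2 * r)) (cψ ^ 2 * ℵ₁ ^ 2 / 10)

lemma amplitude_pos {r 𝒜 ℵ₁ cψ : ℝ} (h𝒜 : 0 < 𝒜) (hℵ₁ : 0 < ℵ₁) (hcψ : 0 < cψ) :
    0 < amplitude r 𝒜 ℵ₁ cψ := by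
  rw [amplitude]
  exact lt_min (by positivity) (by positivity)

section LowerBound
variable {H₁ H₂ Ω : Type*}
  [NormedAddCommGroup H₁] [InnerProductSpace ℝ H₁] [CompleteSpace H₁]
  [MeasurableSpace H₁] [BorelSpace H₁]
  [NormedAddCommGroup H₂] [InnerProductSpace ℝ H₂] [CompleteSpace H₂]
  {A : H₁ →L[ℝ] H₂} {φ : HilbertBasis ℕ ℝ H₁} {ψ η : ℕ → H₂} {ν : ℕ → ℝ}
  {cψ Cψ cη Cη ℵ₁ ℵ₂ α β γ r 𝒜 : ℝ}
  [MeasurableSpace Ω] {P : Measure Ω} [IsProbabilityMeasure P] {M K : ℕ} {ξ : Fin M → H₂ → Ω → ℝ}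

/-- Assouad's bound at frequency `J`, for any assignment `g` of cube vertices that stays in the
class and shares each vertex among at most `2 N` functions. -/
lemma exists_block_avgError_ge
    (hA : IsWVD A φ ψ η ν cψ Cψ cη Cη) (hν : IllPosed ν ℵ₁ ℵ₂ α β γ)
    (hcψ : 0 < cψ) (hℵ₁ : 0 < ℵ₁) (h𝒜 : 0 < 𝒜) (hα : 0 ≤ α) (hβ : 0 ≤ β) (hγ : 0 ≤ γ) (hr : 0 ≤ r)
    (hξ : IsWhiteNoise ξ P) {δ : ℝ} (hδ : 0 < δ) {G : Type*} [Fintype G] [DecidableEq G]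
    (hM : 0 < M) (g : Fin M → G) {N : ℝ} (hg : ∀ k, (Finset.card {m | g m = k} : ℝ) ≤ 2 * N)
    {J d : ℕ} (hd : 0 < d) (hdJ : d ≤ J)
    (hN : N ≤ d * δ ^ 2 * (J : ℝ) ^ (2 * r + 2 * γ) * Real.exp (2 * (α * (J : ℝ) ^ β)))
    (hclass : ∀ (a : ℝ) (b : G → Fin d → Bool),
      (∀ x : Fin d → Bool, cubeVertex φ J a x ∈ sobolevBall φ r 𝒜) →
      (fun m => cubeVertex φ J a (b (g m))) ∈ clusteredClass φ r 𝒜 M K)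
    {t : ℝ} (ht : t ≤ 3 / 80 * (amplitude r 𝒜 ℵ₁ cψ * (J : ℝ) ^ (-(2 * r))))
    {fhat : (Fin (cutoff δ) → Fin M → ℝ) → (Fin M → H₁)} (hfhat : Measurable fhat) :
    ∃ f ∈ clusteredClass φ r 𝒜 M K,
      1 / 10 ≤ P.real {ω | t ≤ avgError f (fhat (observation A ψ ξ δ f ω))} := by
  have hJ : 0 < J := hd.trans_le hdJ
  have hJR : (0 : ℝ) < J := by exact_mod_cast hJ
  have hdR : (0 : ℝ) < d := by exact_mod_cast hd
  set κ := amplitude r 𝒜 ℵ₁ cψ with hκ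
  have hκ0 : 0 < κ := amplitude_pos h𝒜 hℵ₁ hcψ
  have hκ1 : κ * 2 ^ (2 * r) ≤ 𝒜 ^ 2 := by
    rw [← le_div_iff₀ (by positivity)]; exact min_le_left _ _
  have hκ2 : κ ≤ cψ ^ 2 * ℵ₁ ^ 2 / 10 := min_le_right _ _
  set a : ℝ := √(κ * (J : ℝ) ^ (-(2 * r)) / d) with haDef
  have ha : 0 < a := Real.sqrt_pos.mpr (by positivity)
  have ha2 : a ^ 2 = κ * (J : ℝ) ^ (-(2 * r)) / d := Real.sq_sqrt (by positivity)
  have hda2 : d * a ^ 2 = κ * (J : ℝ) ^ (-(2 * r)) := by rw [ha2]; field_simp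
  have hball (x : Fin d → Bool) : cubeVertex φ J a x ∈ sobolevBall φ r 𝒜 := by
    refine cubeVertex_mem_sobolevBall φ J a x hr (le_trans ?_ hκ1)
    rw [hda2]
    have h2J : ((J : ℝ) + d) ^ (2 * r) ≤ 2 ^ (2 * r) * (J : ℝ) ^ (2 * r) := by
      rw [← Real.mul_rpow (by norm_num) hJR.le]
      refine Real.rpow_le_rpow (by positivity) ?_ (by positivity)
      have : (d : ℝ) ≤ J := by exact_mod_cast hdJ
      linarith
    calc κ * (J : ℝ) ^ (-(2 * r)) * ((J : ℝ) + d) ^ (2 * r)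
        ≤ κ * (J : ℝ) ^ (-(2 * r)) * (2 ^ (2 * r) * (J : ℝ) ^ (2 * r)) := by gcongr
      _ = κ * 2 ^ (2 * r) * ((J : ℝ) ^ (-(2 * r)) * (J : ℝ) ^ (2 * r)) := by ring
      _ = κ * 2 ^ (2 * r) := by rw [← Real.rpow_add hJR]; simp
  have hfib (k : G) (i : Fin d) : (Finset.card {m | g m = k} : ℝ) * a ^ 2
      ≤ δ ^ 2 / 5 * (cψ * ν (J + i)) ^ 2 := by
    have hlow := hν.le_abs hℵ₁.le hα hβ hγ (Nat.le_add_right J i)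
    have hsq : (ℵ₁ * (J : ℝ) ^ γ * Real.exp (α * (J : ℝ) ^ β)) ^ 2 ≤ ν (J + i) ^ 2 := by
      rw [← sq_abs (ν _)]
      exact pow_le_pow_left₀ (by positivity) hlow 2
    have he1 : Real.exp (α * (J : ℝ) ^ β) ^ 2 = Real.exp (2 * (α * (J : ℝ) ^ β)) := by
      rw [← Real.exp_nat_mul]; norm_num
    have he2 : ((J : ℝ) ^ γ) ^ 2 = (J : ℝ) ^ (2 * γ) := by
      rw [← Real.rpow_mul_natCast hJR.le]; ring_nf
    have he3 : (J : ℝ) ^ (-(2 * r)) * (J : ℝ) ^ (2 * r + 2 * γ) = (J : ℝ) ^ (2 * γ) := by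
      rw [← Real.rpow_add hJR]; ring_nf
    rw [mul_pow, mul_pow, he1, he2] at hsq
    calc (Finset.card {m | g m = k} : ℝ) * a ^ 2
        ≤ 2 * (d * δ ^ 2 * (J : ℝ) ^ (2 * r + 2 * γ) * Real.exp (2 * (α * (J : ℝ) ^ β)))
            * a ^ 2 := by
          gcongr
          exact (hg k).trans (by gcongr)
      _ = 2 * δ ^ 2 * κ * ((J : ℝ) ^ (-(2 * r)) * (J : ℝ) ^ (2 * r + 2 * γ))
          * Real.exp (2 * (α * (J : ℝ) ^ β)) := by
          rw [ha2]; field_simp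
      _ = 2 * δ ^ 2 * κ * (J : ℝ) ^ (2 * γ) * Real.exp (2 * (α * (J : ℝ) ^ β)) := by rw [he3]
      _ ≤ 2 * δ ^ 2 * (cψ ^ 2 * ℵ₁ ^ 2 / 10) * (J : ℝ) ^ (2 * γ)
          * Real.exp (2 * (α * (J : ℝ) ^ β)) := by gcongr
      _ = δ ^ 2 / 5 * cψ ^ 2 * (ℵ₁ ^ 2 * (J : ℝ) ^ (2 * γ) * Real.exp (2 * (α * (J : ℝ) ^ β))) := by
          ring
      _ ≤ δ ^ 2 / 5 * cψ ^ 2 * ν (J + i) ^ 2 := by gcongr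
      _ = δ ^ 2 / 5 * (cψ * ν (J + i)) ^ 2 := by ring
  obtain ⟨b, hb⟩ := exists_cube_avgError_ge hA hcψ hξ hδ hM g J hd ha hfib hfhat
  refine ⟨_, hclass a b hball, hb.trans (measureReal_mono fun ω hω => ?_)⟩
  rw [hda2] at hω
  exact ht.trans hω

/-- Lower bound from estimating `K` centres with the clusters known and balanced. -/
lemma exists_avgError_ge_of_known_clusters
    (hA : IsWVD A φ ψ η ν cψ Cψ cη Cη) (hν : IllPosed ν ℵ₁ ℵ₂ α β γ)
    (hcψ : 0 < cψ) (hℵ₁ : 0 < ℵ₁) (h𝒜 : 0 < 𝒜) (hα : 0 ≤ α) (hβ : 0 ≤ β) (hγ : 0 ≤ γ) (hr : 0 ≤ r)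
    (hξ : IsWhiteNoise ξ P) {δ : ℝ} (hδ : 0 < δ) (hK : 1 ≤ K) (hKM : K ≤ M)
    {J d : ℕ} (hd : 0 < d) (hdJ : d ≤ J)
    (hJ : (M : ℝ) / K ≤
      d * δ ^ 2 * (J : ℝ) ^ (2 * r + 2 * γ) * Real.exp (2 * (α * (J : ℝ) ^ β)))
    {t : ℝ} (ht : t ≤ 3 / 80 * (amplitude r 𝒜 ℵ₁ cψ * (J : ℝ) ^ (-(2 * r))))
    {fhat : (Fin (cutoff δ) → Fin M → ℝ) → (Fin M → H₁)} (hfhat : Measurable fhat) :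
    ∃ f ∈ clusteredClass φ r 𝒜 M K,
      1 / 10 ≤ P.real {ω | t ≤ avgError f (fhat (observation A ψ ξ δ f ω))} := by
  obtain ⟨g, hg⟩ := exists_balanced_map hK hKM
  exact exists_block_avgError_ge hA hν hcψ hℵ₁ h𝒜 hα hβ hγ hr hξ hδ (hK.trans hKM) g hg hd hdJ hJ
    (fun a b hball => ⟨g, fun k => cubeVertex φ J a (b k), fun k => hball _, fun m => rfl⟩) ht hfhat

/-- Lower bound from not knowing the clusters: the centres are all the vertices of a cube, so every
`f_m` is an arbitrary vertex. -/
lemma exists_avgError_ge_of_full_cube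
    (hA : IsWVD A φ ψ η ν cψ Cψ cη Cη) (hν : IllPosed ν ℵ₁ ℵ₂ α β γ)
    (hcψ : 0 < cψ) (hℵ₁ : 0 < ℵ₁) (h𝒜 : 0 < 𝒜) (hα : 0 ≤ α) (hβ : 0 ≤ β) (hγ : 0 ≤ γ) (hr : 0 ≤ r)
    (hξ : IsWhiteNoise ξ P) {δ : ℝ} (hδ : 0 < δ) (hM : 0 < M)
    {J d : ℕ} (hd : 0 < d) (hdJ : d ≤ J) (hdK : 2 ^ d ≤ K)
    (hJ : 1 ≤ 2 * d * δ ^ 2 * (J : ℝ) ^ (2 * r + 2 * γ) * Real.exp (2 * (α * (J : ℝ) ^ β)))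
    {t : ℝ} (ht : t ≤ 3 / 80 * (amplitude r 𝒜 ℵ₁ cψ * (J : ℝ) ^ (-(2 * r))))
    {fhat : (Fin (cutoff δ) → Fin M → ℝ) → (Fin M → H₁)} (hfhat : Measurable fhat) :
    ∃ f ∈ clusteredClass φ r 𝒜 M K,
      1 / 10 ≤ P.real {ω | t ≤ avgError f (fhat (observation A ψ ξ δ f ω))} := by
  -- a numbering of the vertices; clusters outside its range get an arbitrary vertex as centre
  obtain ⟨e⟩ : Nonempty ((Fin d → Bool) ↪ Fin K) :=
    Function.Embedding.nonempty_of_card_le (by simpa using hdK)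
  refine exists_block_avgError_ge hA hν hcψ hℵ₁ h𝒜 hα hβ hγ hr hξ hδ hM (id : Fin M → Fin M)
    (N := 1 / 2) (fun k => by simp [Finset.filter_eq']) hd hdJ (by linarith)
    (fun a b hball => ?_) ht hfhat
  refine ⟨fun m => e (b m), fun k => cubeVertex φ J a (Function.invFun e k), fun k => hball _,
    fun m => ?_⟩
  simp [Function.leftInverse_invFun e.injective (b m)]

end LowerBound

/-! ### Choice of the frequency -/

section Rates

lemma exists_nat_scale {T p : ℝ} (hT : 1 ≤ T) (hp : 0 ≤ p) :
    ∃ J : ℕ, 1 ≤ J ∧ T ≤ J ∧ (2 * T) ^ (-p) ≤ (J : ℝ) ^ (-p) := by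
  have hT0 : 0 < T := by linarith
  refine ⟨⌈T⌉₊, Nat.one_le_ceil_iff.mpr hT0, Nat.le_ceil T, ?_⟩
  refine Real.rpow_le_rpow_of_nonpos ?_ ?_ (by linarith)
  · exact_mod_cast Nat.ceil_pos.mpr hT0
  · have := Nat.ceil_lt_add_one hT0.le
    linarith

lemma le_rpow_of_rpow_inv_le {x y ρ : ℝ} (hx : 0 < x) (hρ : 0 < ρ) (h : x ^ (-(1 / ρ)) ≤ y) :
    x⁻¹ ≤ y ^ ρ := by
  have h1 := Real.rpow_le_rpow (by positivity) h hρ.le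
  rwa [← Real.rpow_mul hx.le, show -(1 / ρ) * ρ = -1 by field_simp, Real.rpow_neg_one] at h1

/-- The least frequency `J` up to constants with `y⁻¹ ≤ J ^ ρ` that leaves room for a block of
length `d`. -/
lemma exists_scale_polynomial {y ρ p D : ℝ} {d : ℕ} (hy : 0 < y) (hρ : 0 < ρ) (hp : 0 ≤ p)
    (hd : 1 ≤ d) (hD : 1 ≤ D) (hdD : d ≤ D * y ^ (-(1 / ρ))) :
    ∃ J : ℕ, d ≤ J ∧ y⁻¹ ≤ (J : ℝ) ^ ρ ∧ (2 * D) ^ (-p) * y ^ (p / ρ) ≤ (J : ℝ) ^ (-p) := by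
  have hyp : 0 < y ^ (-(1 / ρ)) := by positivity
  have hT : 1 ≤ D * y ^ (-(1 / ρ)) := le_trans (by exact_mod_cast hd) hdD
  obtain ⟨J, h1, h2, h3⟩ := exists_nat_scale hT hp
  refine ⟨J, by exact_mod_cast hdD.trans h2, le_rpow_of_rpow_inv_le hy hρ ?_,
    le_trans (le_of_eq ?_) h3⟩
  · exact le_trans (le_mul_of_one_le_left hyp.le hD) h2
  · rw [← mul_assoc, Real.mul_rpow (x := 2 * D) (by positivity) (by positivity),
      ← Real.rpow_mul hy.le]
    congr 2
    field_simp

/-- The least frequency `J` up to constants with `Λ ≤ 2 α J ^ β`. -/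
lemma exists_scale_exponential {α β p Λ : ℝ} (hα : 0 < α) (hβ : 0 < β) (hp : 0 ≤ p)
    (hΛ : 2 * α ≤ Λ) : ∃ J : ℕ, 1 ≤ J ∧ Real.exp Λ ≤ Real.exp (2 * (α * (J : ℝ) ^ β)) ∧
      2 ^ (-p) * (2 * α) ^ (p / β) * Λ ^ (-(p / β)) ≤ (J : ℝ) ^ (-p) := by
  have hΛ0 : 0 < Λ := by linarith
  have hq : 1 ≤ Λ / (2 * α) := by rw [le_div_iff₀ (by positivity)]; linarith
  have hT : 1 ≤ (Λ / (2 * α)) ^ (1 / β) := Real.one_le_rpow hq (by positivity)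
  obtain ⟨J, h1, h2, h3⟩ := exists_nat_scale hT hp
  refine ⟨J, h1, Real.exp_le_exp.mpr ?_, le_trans (le_of_eq ?_) h3⟩
  · have := Real.rpow_le_rpow (by positivity) h2 hβ.le
    rw [← Real.rpow_mul (by positivity), one_div_mul_cancel hβ.ne', Real.rpow_one,
      div_le_iff₀ (by positivity)] at this
    linarith
  · rw [Real.mul_rpow (x := 2) (y := (Λ / (2 * α)) ^ (1 / β)) (by norm_num) (by positivity),
      ← Real.rpow_mul (x := Λ / (2 * α)) (by positivity),
      Real.div_rpow hΛ0.le (by positivity), mul_assoc,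
      show 1 / β * -p = -(p / β) by ring, Real.rpow_neg (x := 2 * α) (by positivity)]
    field_simp

/-- A logarithmic quantity `L` is at most a constant times `(δ² L) ^ (-1/ρ)`, as `δ ^ s ln δ⁻¹` is
bounded by `1 / s`. -/
lemma le_mul_rpow_of_le_log {c ρ δ L : ℝ} (hc : 0 < c) (hρ : 0 < ρ) (hδ : 0 < δ) (hL : 0 < L)
    (hLc : L ≤ c * Real.log δ⁻¹) :
    L ≤ (c * ((1 + ρ) / 2)) ^ (1 / ρ + 1) * (δ ^ 2 * L) ^ (-(1 / ρ)) := by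
  set s : ℝ := 2 / (1 + ρ) with hs
  have hs0 : 0 < s := by positivity
  have hlog : Real.log δ⁻¹ ≤ (δ⁻¹) ^ s / s := Real.log_le_rpow_div (by positivity) hs0
  have hsL : δ ^ s * L ≤ c * ((1 + ρ) / 2) := by
    calc δ ^ s * L ≤ δ ^ s * (c * ((δ⁻¹) ^ s / s)) := by
          gcongr
          exact hLc.trans (by gcongr)
      _ = c * ((1 + ρ) / 2) := by
          rw [Real.inv_rpow hδ.le, hs]
          have : δ ^ (2 / (1 + ρ)) ≠ 0 := by positivity
          field_simp
  have hpow := Real.rpow_le_rpow (by positivity) hsL (by positivity : 0 ≤ 1 / ρ + 1)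
  calc L = (δ ^ s * L) ^ (1 / ρ + 1) * (δ ^ 2 * L) ^ (-(1 / ρ)) := by
        rw [Real.mul_rpow (by positivity) hL.le, Real.mul_rpow (by positivity) hL.le,
          ← Real.rpow_mul hδ.le, ← Real.rpow_natCast, ← Real.rpow_mul hδ.le]
        have h1 : δ ^ (s * (1 / ρ + 1)) * δ ^ (((2 : ℕ) : ℝ) * -(1 / ρ)) = 1 := by
          rw [← Real.rpow_add hδ, hs]
          have : 2 / (1 + ρ) * (1 / ρ + 1) + ((2 : ℕ) : ℝ) * -(1 / ρ) = 0 := by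
            push_cast
            field_simp
            ring
          rw [this, Real.rpow_zero]
        have h2 : L ^ (1 / ρ + 1) * L ^ (-(1 / ρ)) = L := by
          rw [← Real.rpow_add hL]
          ring_nf
          exact Real.rpow_one L
        rw [mul_mul_mul_comm, h1, h2, one_mul]
    _ ≤ _ := by gcongr

end Rates

/-! ### The two regimes of ill-posedness -/

section Regimes
variable {H₁ H₂ Ω : Type*}
  [NormedAddCommGroup H₁] [InnerProductSpace ℝ H₁] [CompleteSpace H₁]
  [MeasurableSpace H₁] [BorelSpace H₁]
  [NormedAddCommGroup H₂] [InnerProductSpace ℝ H₂] [CompleteSpace H₂]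
  {A : H₁ →L[ℝ] H₂} {φ : HilbertBasis ℕ ℝ H₁} {ψ η : ℕ → H₂} {ν : ℕ → ℝ}
  {cψ Cψ cη Cη ℵ₁ ℵ₂ α β γ r 𝒜 : ℝ}
  [MeasurableSpace Ω] {P : Measure Ω} [IsProbabilityMeasure P] {M K : ℕ} {ξ : Fin M → H₂ → Ω → ℝ}

/-- The mildly ill-posed case, `α = β = 0`. The constant `D` bounds the ratio of `log₂ K` to the
frequency `(δ² ln K) ^ (-1 / (2r + 2γ))`, so that the block of length `⌊log₂ K⌋` fits. -/
lemma exists_avgError_ge_rateModerate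
    (hA : IsWVD A φ ψ η ν cψ Cψ cη Cη) (hν : IllPosed ν ℵ₁ ℵ₂ 0 0 γ)
    (hcψ : 0 < cψ) (hℵ₁ : 0 < ℵ₁) (h𝒜 : 0 < 𝒜) (hγ : 0 ≤ γ) (hr : 0 < r)
    (hξ : IsWhiteNoise ξ P) {δ : ℝ} (hδ : 0 < δ) (hδ1 : δ ≤ 1) (hK : 1 ≤ K) (hKM : K ≤ M)
    {c : ℝ} (hc : 0 < c) (hcM : Real.log M ≤ c * Real.log δ⁻¹) {D : ℝ} (hD1 : 1 ≤ D)
    (hD : 2 * (c * ((1 + (2 * r + 2 * γ)) / 2)) ^ (1 / (2 * r + 2 * γ) + 1) ≤ D)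
    {fhat : (Fin (cutoff δ) → Fin M → ℝ) → (Fin M → H₁)} (hfhat : Measurable fhat) :
    ∃ f ∈ clusteredClass φ r 𝒜 M K,
      1 / 10 ≤ P.real {ω | 3 / 80 * amplitude r 𝒜 ℵ₁ cψ * (2 * D) ^ (-(2 * r)) *
        rateModerate γ r M K δ ≤ avgError f (fhat (observation A ψ ξ δ f ω))} := by
  have hκ := amplitude_pos (r := r) h𝒜 hℵ₁ hcψ
  have hKR : (1 : ℝ) ≤ K := by exact_mod_cast hK
  have hKMR : (K : ℝ) ≤ M := by exact_mod_cast hKM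
  have hMR : (0 : ℝ) < M := by linarith
  set C := 3 / 80 * amplitude r 𝒜 ℵ₁ cψ * (2 * D) ^ (-(2 * r)) with hC
  have hC0 : 0 < C := by positivity
  have hscale {J : ℕ} {R : ℝ} (h : (2 * D) ^ (-(2 * r)) * R ≤ (J : ℝ) ^ (-(2 * r))) :
      C * R ≤ 3 / 80 * (amplitude r 𝒜 ℵ₁ cψ * (J : ℝ) ^ (-(2 * r))) := by
    calc C * R = 3 / 80 * (amplitude r 𝒜 ℵ₁ cψ * ((2 * D) ^ (-(2 * r)) * R)) := by rw [hC]; ring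
      _ ≤ _ := by gcongr
  rw [rateModerate]
  set R₁ := (δ ^ 2 * Real.log K) ^ (2 * r / (2 * r + 2 * γ)) with hR₁
  set R₂ := (δ ^ 2 * (M : ℝ)⁻¹ * K) ^ (2 * r / (2 * r + 2 * γ + 1)) with hR₂
  by_cases hcase : 2 ≤ K ∧ R₂ ≤ R₁
  · obtain ⟨hK2, hR⟩ := hcase
    rw [max_eq_left hR]
    have hK2R : (1 : ℝ) < K := by exact_mod_cast hK2
    have hL : 0 < Real.log K := Real.log_pos hK2R
    have hLc : Real.log K ≤ c * Real.log δ⁻¹ :=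
      (Real.log_le_log (by linarith) hKMR).trans hcM
    set d := Nat.log 2 K with hd
    have hd1 : 1 ≤ d := Nat.log_pos (by norm_num) hK2
    have hdK : 2 ^ d ≤ K := Nat.pow_log_le_self 2 (by omega)
    have hKd : (K : ℝ) < 2 ^ (d + 1) := by exact_mod_cast Nat.lt_pow_succ_log_self (by norm_num) K
    have hl2 : (1 / 2 : ℝ) ≤ Real.log 2 := by linarith [Real.log_two_gt_d9]
    have hl2' : Real.log 2 ≤ 1 := by linarith [Real.log_two_lt_d9]
    have hd1R : (1 : ℝ) ≤ d := by exact_mod_cast hd1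
    have hdlog : d * Real.log 2 ≤ Real.log K := by
      rw [← Real.log_pow]
      exact Real.log_le_log (by positivity) (by exact_mod_cast hdK)
    have hlogd : Real.log K ≤ (d + 1) * Real.log 2 := by
      have := Real.log_le_log (by linarith) hKd.le
      rwa [Real.log_pow, Nat.cast_add, Nat.cast_one] at this
    have hdL : (d : ℝ) ≤ 2 * Real.log K := by nlinarith
    have hLd : Real.log K ≤ 2 * d := by nlinarith
    have hρ : 0 < 2 * r + 2 * γ := by positivity
    have hy : 0 < δ ^ 2 * Real.log K := by positivity
    have hdD : (d : ℝ) ≤ D * (δ ^ 2 * Real.log K) ^ (-(1 / (2 * r + 2 * γ))) := by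
      have h1 := le_mul_rpow_of_le_log hc hρ hδ hL hLc
      calc (d : ℝ) ≤ 2 * Real.log K := hdL
        _ ≤ 2 * ((c * ((1 + (2 * r + 2 * γ)) / 2)) ^ (1 / (2 * r + 2 * γ) + 1) *
          (δ ^ 2 * Real.log K) ^ (-(1 / (2 * r + 2 * γ)))) := by gcongr
        _ ≤ _ := by rw [← mul_assoc]; gcongr
    obtain ⟨J, hdJ, hJ, hJR⟩ :=
      exists_scale_polynomial hy hρ (by positivity : 0 ≤ 2 * r) hd1 hD1 hdD
    refine exists_avgError_ge_of_full_cube hA hν hcψ hℵ₁ h𝒜 le_rfl le_rfl hγ hr.le hξ hδ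
      (by omega) hd1 hdJ hdK ?_ (hscale hJR) hfhat
    rw [zero_mul, mul_zero, Real.exp_zero, mul_one]
    calc (1 : ℝ) = δ ^ 2 * Real.log K * (δ ^ 2 * Real.log K)⁻¹ := by field_simp
      _ ≤ δ ^ 2 * (2 * d) * (J : ℝ) ^ (2 * r + 2 * γ) := by gcongr
      _ = _ := by ring
  · have hR : R₁ ≤ R₂ := by
      by_cases hK2 : 2 ≤ K
      · exact le_of_not_ge fun h => hcase ⟨hK2, h⟩
      -- for `K = 1` the first term vanishes, as `ln 1 = 0`
      · have : K = 1 := by omega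
        have hzero : R₁ = 0 := by
          rw [hR₁, this, Nat.cast_one, Real.log_one, mul_zero, Real.zero_rpow (by positivity)]
        rw [hzero]
        positivity
    rw [max_eq_right hR]
    have hx : 0 < δ ^ 2 * (M : ℝ)⁻¹ * K := by positivity
    have hx1 : δ ^ 2 * (M : ℝ)⁻¹ * K ≤ 1 := by
      have h1 : (M : ℝ)⁻¹ * K ≤ 1 := by rw [inv_mul_le_iff₀ hMR]; linarith
      have h2 : δ ^ 2 ≤ 1 := by nlinarith
      rw [mul_assoc]
      exact mul_le_one₀ h2 (by positivity) h1
    have hρ : 0 < 2 * r + 2 * γ + 1 := by positivity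
    have h1D : ((1 : ℕ) : ℝ) ≤ D * (δ ^ 2 * (M : ℝ)⁻¹ * K) ^ (-(1 / (2 * r + 2 * γ + 1))) := by
      rw [Nat.cast_one]
      refine one_le_mul_of_one_le_of_one_le hD1
        (Real.one_le_rpow_of_pos_of_le_one_of_nonpos hx hx1 ?_)
      rw [neg_nonpos]; positivity
    obtain ⟨J, hJ1, hJ, hJR⟩ :=
      exists_scale_polynomial hx hρ (by positivity : 0 ≤ 2 * r) le_rfl hD1 h1D
    have hJ0 : (0 : ℝ) < J := by exact_mod_cast hJ1
    refine exists_avgError_ge_of_known_clusters hA hν hcψ hℵ₁ h𝒜 le_rfl le_rfl hγ hr.le hξ hδ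
      hK hKM hJ1 le_rfl ?_ (hscale hJR) hfhat
    rw [zero_mul, mul_zero, Real.exp_zero, mul_one]
    calc (M : ℝ) / K = δ ^ 2 * (δ ^ 2 * (M : ℝ)⁻¹ * K)⁻¹ := by field_simp
      _ ≤ δ ^ 2 * (J : ℝ) ^ (2 * r + 2 * γ + 1) := by gcongr
      _ = _ := by rw [Real.rpow_add_one hJ0.ne']; ring

/-- For small `δ`, the bound `c ln δ⁻¹` is at most `δ⁻¹`. -/
lemma le_inv_of_le_log {c δ L : ℝ} (hc : 0 < c) (hδ : 0 < δ) (hδc : δ ≤ 1 / (4 * c ^ 2))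
    (hL : L ≤ c * Real.log δ⁻¹) : L ≤ δ⁻¹ := by
  set s := √δ⁻¹ with hs
  have hs0 : 0 < s := Real.sqrt_pos.mpr (by positivity)
  have hs2 : s ^ 2 = δ⁻¹ := Real.sq_sqrt (by positivity)
  have hlog : Real.log δ⁻¹ ≤ 2 * s := by
    rw [← hs2, Real.log_pow]
    have := Real.log_le_self hs0.le
    push_cast
    linarith
  have hcs : 2 * c ≤ s := by
    refine le_of_sq_le_sq ?_ hs0.le
    rw [hs2, le_inv_comm₀ (by positivity) hδ]
    convert! hδc using 1
    rw [one_div]; ring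
  calc L ≤ c * (2 * s) := hL.trans (by gcongr)
    _ ≤ s ^ 2 := by nlinarith
    _ = δ⁻¹ := hs2

/-- The severely ill-posed case, `α, β > 0`. One bit for each function or cluster suffices. -/
lemma exists_avgError_ge_rateSevere
    (hA : IsWVD A φ ψ η ν cψ Cψ cη Cη) (hν : IllPosed ν ℵ₁ ℵ₂ α β γ)
    (hcψ : 0 < cψ) (hℵ₁ : 0 < ℵ₁) (h𝒜 : 0 < 𝒜) (hα : 0 < α) (hβ : 0 < β) (hγ : 0 ≤ γ)
    (hr : 0 < r) (hξ : IsWhiteNoise ξ P) {δ : ℝ} (hδ : 0 < δ) (hK : 1 ≤ K) (hKM : K ≤ M)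
    {c : ℝ} (hc : 0 < c) (hcM : Real.log M ≤ c * Real.log δ⁻¹)
    (hδα : δ ≤ Real.exp (-α)) (hδc : δ ≤ 1 / (4 * c ^ 2))
    {fhat : (Fin (cutoff δ) → Fin M → ℝ) → (Fin M → H₁)} (hfhat : Measurable fhat) :
    ∃ f ∈ clusteredClass φ r 𝒜 M K,
      1 / 10 ≤ P.real {ω | 3 / 80 * amplitude r 𝒜 ℵ₁ cψ * (2 ^ (-(2 * r)) * α ^ (2 * r / β)) *
        rateSevere β r M K δ ≤ avgError f (fhat (observation A ψ ξ δ f ω))} := by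
  have hκ := amplitude_pos (r := r) h𝒜 hℵ₁ hcψ
  have hKR : (1 : ℝ) ≤ K := by exact_mod_cast hK
  have hKMR : (K : ℝ) ≤ M := by exact_mod_cast hKM
  have hMR : (0 : ℝ) < M := by linarith
  have hlogδ : α ≤ Real.log δ⁻¹ := by
    have := Real.log_le_log hδ hδα
    rw [Real.log_exp] at this
    rw [Real.log_inv]
    linarith
  set C := 3 / 80 * amplitude r 𝒜 ℵ₁ cψ * (2 ^ (-(2 * r)) * α ^ (2 * r / β)) with hC
  have hC0 : 0 < C := by positivity
  have hscale {J : ℕ} {Λ R : ℝ} (hΛ : 0 < Λ)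
      (h : 2 ^ (-(2 * r)) * (2 * α) ^ (2 * r / β) * Λ ^ (-(2 * r / β)) ≤ (J : ℝ) ^ (-(2 * r)))
      (hR : R ≤ (Λ / 2) ^ (-(2 * r / β))) :
      C * R ≤ 3 / 80 * (amplitude r 𝒜 ℵ₁ cψ * (J : ℝ) ^ (-(2 * r))) := by
    have h2 : α ^ (2 * r / β) * (Λ / 2) ^ (-(2 * r / β))
        = (2 * α) ^ (2 * r / β) * Λ ^ (-(2 * r / β)) := by
      rw [Real.div_rpow hΛ.le (by norm_num), Real.mul_rpow (by norm_num) hα.le,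
        Real.rpow_neg (x := 2) (by norm_num)]
      field_simp
    calc C * R ≤ C * (Λ / 2) ^ (-(2 * r / β)) := by gcongr
      _ = 3 / 80 * (amplitude r 𝒜 ℵ₁ cψ * (2 ^ (-(2 * r)) *
          (α ^ (2 * r / β) * (Λ / 2) ^ (-(2 * r / β))))) := by rw [hC]; ring
      _ ≤ _ := by
        rw [h2, ← mul_assoc (2 ^ (-(2 * r)))]
        gcongr
  have hJpow {J : ℕ} (hJ1 : 1 ≤ J) : (1 : ℝ) ≤ (J : ℝ) ^ (2 * r + 2 * γ) :=
    Real.one_le_rpow (by exact_mod_cast hJ1) (by positivity)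
  rw [rateSevere]
  set R₁ := (if K = 1 then 0 else (Real.log (1 / (δ ^ 2 * Real.log K))) ^ (-(2 * r / β))) with hR₁
  set R₂ := (Real.log (M / (δ ^ 2 * K))) ^ (-(2 * r / β)) with hR₂
  have hΛM : 2 * Real.log δ⁻¹ ≤ Real.log (M / (δ ^ 2 * K)) := by
    have : 2 * Real.log δ⁻¹ = Real.log ((δ⁻¹) ^ 2) := by rw [Real.log_pow]; norm_num
    rw [this]
    refine Real.log_le_log (by positivity) ?_
    rw [inv_pow, le_div_iff₀ (by positivity), ← mul_assoc, inv_mul_cancel₀ (by positivity), one_mul]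
    exact hKMR
  have hΛM0 : 0 < Real.log (M / (δ ^ 2 * K)) := by linarith
  by_cases hcase : 2 ≤ K ∧ R₂ ≤ R₁
  · obtain ⟨hK2, hR⟩ := hcase
    rw [max_eq_left hR]
    have hL : 0 < Real.log K := Real.log_pos (by exact_mod_cast hK2)
    have hLδ : Real.log K ≤ δ⁻¹ :=
      le_inv_of_le_log hc hδ hδc ((Real.log_le_log (by linarith) hKMR).trans hcM)
    have hR₁le : R₁ ≤ (2 * Real.log δ⁻¹ / 2) ^ (-(2 * r / β)) := by
      rw [hR₁, if_neg (by omega)]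
      have hlog : 2 * Real.log δ⁻¹ / 2 ≤ Real.log (1 / (δ ^ 2 * Real.log K)) := by
        rw [mul_div_cancel_left₀ _ (by norm_num)]
        refine Real.log_le_log (by positivity) ?_
        rw [inv_eq_one_div]
        refine one_div_le_one_div_of_le (by positivity) ?_
        calc δ ^ 2 * Real.log K ≤ δ ^ 2 * δ⁻¹ := by gcongr
          _ = δ := by field_simp
      exact Real.rpow_le_rpow_of_nonpos (by linarith) hlog (by rw [neg_nonpos]; positivity)
    obtain ⟨J, hJ1, hJ, hJR⟩ := exists_scale_exponential (p := 2 * r) (Λ := 2 * Real.log δ⁻¹)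
      hα hβ (by positivity) (by linarith)
    refine exists_avgError_ge_of_full_cube hA hν hcψ hℵ₁ h𝒜 hα.le hβ.le hγ hr.le hξ hδ
      (by omega) one_pos hJ1 (by simpa using hK2) ?_ (hscale (by linarith) hJR hR₁le) hfhat
    have hexp : Real.exp (2 * Real.log δ⁻¹) = (δ⁻¹) ^ 2 := by
      rw [two_mul, Real.exp_add, Real.exp_log (by positivity), sq]
    rw [hexp] at hJ
    have := hJpow hJ1
    calc (1 : ℝ) ≤ 2 * 1 * δ ^ 2 * 1 * (δ⁻¹) ^ 2 := by
          field_simp; norm_num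
      _ ≤ _ := by push_cast; gcongr
  · have hR : R₁ ≤ R₂ := by
      by_cases hK2 : 2 ≤ K
      · exact le_of_not_ge fun h => hcase ⟨hK2, h⟩
      · rw [hR₁, if_pos (by omega)]
        positivity
    rw [max_eq_right hR]
    obtain ⟨J, hJ1, hJ, hJR⟩ := exists_scale_exponential (p := 2 * r)
      (Λ := Real.log (M / (δ ^ 2 * K))) hα hβ (by positivity) (by linarith)
    refine exists_avgError_ge_of_known_clusters hA hν hcψ hℵ₁ h𝒜 hα.le hβ.le hγ hr.le hξ hδ
      hK hKM one_pos hJ1 ?_ (hscale hΛM0 hJR ?_) hfhat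
    · rw [Real.exp_log (by positivity)] at hJ
      have := hJpow hJ1
      calc (M : ℝ) / K = 1 * δ ^ 2 * 1 * (M / (δ ^ 2 * K)) := by field_simp
        _ ≤ _ := by push_cast; gcongr
    · exact Real.rpow_le_rpow_of_nonpos (by linarith) (by linarith)
        (by rw [neg_nonpos]; positivity)

end Regimes

theorem theorem3
    -- the parameters of the problem; either `α = β = 0` and `γ > 0`, or `α, β > 0` and `γ ≥ 0`
    (α β γ r 𝒜 : ℝ) (hγ : 0 ≤ γ)
    (hαβ : (α = 0 ∧ β = 0 ∧ 0 < γ) ∨ (0 < α ∧ 0 < β))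
    (hr : 1 / 2 ≤ r) (h𝒜 : 0 < 𝒜)
    -- absolute constants, and the constant in `ln M ≲ ln δ⁻¹`
    (ℵ₁ cψ c : ℝ) (hℵ₁ : 0 < ℵ₁) (hcψ : 0 < cψ) (hc : 0 < c) :
    ∃ C : ℝ, 0 < C ∧ ∃ δ₀ : ℝ, 0 < δ₀ ∧
      ∀ (ℵ₂ Cψ cη Cη : ℝ), 0 < ℵ₂ → 0 < Cψ → 0 < cη → 0 < Cη →
      ∀ (H₁ : Type*) [NormedAddCommGroup H₁] [InnerProductSpace ℝ H₁] [CompleteSpace H₁]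
        [MeasurableSpace H₁] [BorelSpace H₁]
        (H₂ : Type*) [NormedAddCommGroup H₂] [InnerProductSpace ℝ H₂] [CompleteSpace H₂]
        (A : H₁ →L[ℝ] H₂) (φ : HilbertBasis ℕ ℝ H₁) (ψ η : ℕ → H₂) (ν : ℕ → ℝ),
      IsWVD A φ ψ η ν cψ Cψ cη Cη →
      IllPosed ν ℵ₁ ℵ₂ α β γ →
      ∀ (δ : ℝ), 0 < δ → δ ≤ 1 → (0 < α → δ ≤ δ₀) →
      ∀ (M K : ℕ), 1 ≤ K → K ≤ M → Real.log M ≤ c * Real.log δ⁻¹ →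
      ∀ (Ω : Type*) [MeasurableSpace Ω] (P : Measure Ω) [IsProbabilityMeasure P]
        (ξ : Fin M → H₂ → Ω → ℝ), IsWhiteNoise ξ P →
      -- every estimator based on the matrix of observations
      ∀ fhat : (Fin (cutoff δ) → Fin M → ℝ) → (Fin M → H₁), Measurable fhat →
        ∃ f ∈ clusteredClass φ r 𝒜 M K,
          1 / 10 ≤ P.real {ω | C * rateMin α β γ r M K δ
            ≤ avgError f (fhat (observation A ψ ξ δ f ω))} := by
  have hr0 : 0 < r := by linarith
  have hκ := amplitude_pos (r := r) h𝒜 hℵ₁ hcψ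
  rcases hαβ with ⟨rfl, rfl, -⟩ | ⟨hα, hβ⟩
  · set D : ℝ := max 1 (2 * (c * ((1 + (2 * r + 2 * γ)) / 2)) ^ (1 / (2 * r + 2 * γ) + 1)) with hD
    have hD1 : 1 ≤ D := le_max_left _ _
    refine ⟨3 / 80 * amplitude r 𝒜 ℵ₁ cψ * (2 * D) ^ (-(2 * r)), by positivity, 1, one_pos, ?_⟩
    intro ℵ₂ Cψ cη Cη _ _ _ _ H₁ _ _ _ _ _ H₂ _ _ _ A φ ψ η ν hA hν δ hδ hδ1 _ M K hK hKM hcM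
      Ω _ P _ ξ hξ fhat hfhat
    rw [rateMin, if_pos rfl]
    exact exists_avgError_ge_rateModerate hA hν hcψ hℵ₁ h𝒜 hγ hr0 hξ hδ hδ1 hK hKM hc hcM hD1
      (le_max_right _ _) hfhat
  · refine ⟨3 / 80 * amplitude r 𝒜 ℵ₁ cψ * (2 ^ (-(2 * r)) * α ^ (2 * r / β)), by positivity,
      min (Real.exp (-α)) (1 / (4 * c ^ 2)), by positivity, ?_⟩
    intro ℵ₂ Cψ cη Cη _ _ _ _ H₁ _ _ _ _ _ H₂ _ _ _ A φ ψ η ν hA hν δ hδ _ hδ₀ M K hK hKM hcM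
      Ω _ P _ ξ hξ fhat hfhat
    rw [rateMin, if_neg hα.ne']
    exact exists_avgError_ge_rateSevere hA hν hcψ hℵ₁ h𝒜 hα hβ hγ hr0 hξ hδ hK hKM hc hcM
      ((hδ₀ hα).trans (min_le_left _ _)) ((hδ₀ hα).trans (min_le_right _ _)) hfhat
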